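/- Let $K$ be a compact Hausdorff space and $n\ge 1$ an integer. Let $C(K)$ be the Banach lattice of continuous real functions on $K$ with the supremum norm $\|\cdot\|_\infty$, and let $\mathcal M(K)$ be the ordered vector space of regular Borel signed measures on $K$, with $\mu\le\nu$ iff $\mu(B)\le\nu(B)$ for all Borel sets $B$. For $\mu\in\mathcal M(K)$ with Jordan decomposition $\mu=\mu^+-\mu^-$ put $\|\mu\|_1=|\mu|(K)$ and $\|\mu\|_0=\max\{\|\mu^+\|_1,\|\mu^-\|_1\}$. A function $P\colon C(K)\to\mathbb R$ is an $n$-homogeneous polynomial if $P(x)=A(x,\dots,x)$ for a bounded $n$-linear form $A$ on $C(K)$; there is then a unique symmetric such $A$, denoted $A_P$. Write $P\le Q$ if $A_P(x_1,\dots,x_n)\le A_Q(x_1,\dots,x_n)$ for all $x_1,\dots,x_n\ge 0$. Let $|P|$ be the least upper bound of $P$ and $-P$ for this order, when it exists, and put $\|P\|_\infty=\sup\{|P(x)|:\|x\|_\infty\le1\}$ and $\|P\|_r=\|\,|P|\,\|_\infty$ (the regular norm). Let $\mathcal P_o({}^nC(K))$ be the ordered vector space of those $n$-homogeneous polynomials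 $P$ that are orthogonally additive: $P(x+y)=P(x)+P(y)$ whenever $|x|\wedge|y|=0$. Then every $P\in\mathcal P_o({}^nC(K))$ has an absolute value $|P|$, and $|P|\in\mathcal P_o({}^nC(K))$; moreover the formula $$(J_n\mu)(x)=\int_K x^n\,d\mu\qquad(\mu\in\mathcal M(K),\ x\in C(K))$$ defines a linear bijection $J_n\colon\mathcal M(K)\to\mathcal P_o({}^nC(K))$ with the following properties. (a) $(\mathcal M(K),\|\cdot\|_1)$ and $(\mathcal P_o({}^nC(K)),\|\cdot\|_r)$ are Banach lattices and $J_n$ is a Banach lattice isometric isomorphism between them, that is, it preserves suprema and infima of pairs and $\|J_n\mu\|_r=\|\mu\|_1$ for all $\mu$. (b) If $n$ is odd, then $\|P\|_r=\|P\|_\infty$ for every $P\in\mathcal P_o({}^nC(K))$, and so $J_n$ is an isometric isomorphism from $(\mathcal M(K),\|\cdot\|_1)$ onto $(\mathcal P_o({}^nC(K)),\|\cdot\|_\infty)$. (c) If $n$ is even, then $\|\cdot\|_0$ is a norm on $\mathcal M(K)$ and $J_n$ is an isometric isomorphism from $(\mathcal M(K),\|\cdot\|_0)$ onto $(\mathcal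 P_o({}^nC(K)),\|\cdot\|_\infty)$. -/

import Mathlib

open MeasureTheory Filter Topology

noncomputable section

section HomogeneousPolynomials

variable (n : ℕ) (E : Type*) [NormedAddCommGroup E] [NormedSpace ℝ E]

/-- The functions `P : E → ℝ` of the form `P x = A (x, …, x)` for some bounded `n`-linear
form `A`. -/
def homogPolySubmodule : Submodule ℝ (E → ℝ) where
  carrier := {P | ∃ A : ContinuousMultilinearMap ℝ (fun _ : Fin n => E) ℝ,
    ∀ x, P x = A (fun _ => x)}
  add_mem' := by
    rintro P Q ⟨A, hA⟩ ⟨B, hB⟩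
    exact ⟨A + B, fun x => by simp [hA, hB]⟩
  zero_mem' := ⟨0, fun x => by simp⟩
  smul_mem' := by
    rintro c P ⟨A, hA⟩
    exact ⟨c • A, fun x => by simp [hA]⟩

/-- The space of bounded `n`-homogeneous polynomials on `E`.  (A separate type, so that it does
not inherit the pointwise order of functions.) -/
def HomogPoly : Type _ := ↥(homogPolySubmodule n E)

instance : AddCommGroup (HomogPoly n E) := inferInstanceAs (AddCommGroup (homogPolySubmodule n E))

instance : Module ℝ (HomogPoly n E) := inferInstanceAs (Module ℝ (homogPolySubmodule n E))

instance : FunLike (HomogPoly n E) E ℝ where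
  coe P := P.1
  coe_injective _ _ h := Subtype.ext h

variable {n E}

namespace HomogPoly

theorem add_apply (P Q : HomogPoly n E) (x : E) : (P + Q) x = P x + Q x := rfl

theorem smul_apply (c : ℝ) (P : HomogPoly n E) (x : E) : (c • P) x = c * P x := rfl

theorem zero_apply (x : E) : (0 : HomogPoly n E) x = 0 := rfl

/-- `A` is the symmetric bounded `n`-linear form generating `P`. -/
def IsFormOf (A : ContinuousMultilinearMap ℝ (fun _ : Fin n => E) ℝ) (P : HomogPoly n E) : Prop :=
  (∀ (σ : Equiv.Perm (Fin n)) (v : Fin n → E), A (fun i => v (σ i)) = A v) ∧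
    ∀ x, P x = A (fun _ => x)

theorem exists_isFormOf (P : HomogPoly n E) : ∃ A, IsFormOf A P := by
  obtain ⟨A, hA⟩ := P.2
  have hn : (n.factorial : ℝ) ≠ 0 := by exact_mod_cast n.factorial_ne_zero
  have key : ∀ v, iteratedFDeriv ℝ n (fun x : E => A (fun _ => x)) 0 v
      = ∑ σ : Equiv.Perm (Fin n), A (fun i => v (σ i)) :=
    A.iteratedFDeriv_comp_diagonal 0
  refine ⟨(n.factorial : ℝ)⁻¹ • iteratedFDeriv ℝ n (fun x : E => A (fun _ => x)) 0, ?_, ?_⟩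
  · intro τ v
    simp only [_root_.smul_apply, key]
    congr 1
    exact Fintype.sum_equiv (Equiv.mulLeft τ) _ _ (fun σ => rfl)
  · intro x
    simp only [_root_.smul_apply, key]
    have h1 : P x = A (fun _ => x) := hA x
    simp [Fintype.card_perm, h1, hn]

theorem IsFormOf.unique {A B : ContinuousMultilinearMap ℝ (fun _ : Fin n => E) ℝ}
    {P : HomogPoly n E} (hA : IsFormOf A P) (hB : IsFormOf B P) : A = B := by
  have hn : (n.factorial : ℝ) ≠ 0 := by exact_mod_cast n.factorial_ne_zero
  have key : ∀ C : ContinuousMultilinearMap ℝ (fun _ : Fin n => E) ℝ, IsFormOf C P → ∀ v,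
      iteratedFDeriv ℝ n (fun x => P x) 0 v = n.factorial * C v := by
    intro C hC v
    have h1 : (fun x => P x) = fun x => C (fun _ => x) := funext hC.2
    rw [h1, C.iteratedFDeriv_comp_diagonal 0 v]
    simp [hC.1, Fintype.card_perm]
  ext v
  have := (key A hA v).symm.trans (key B hB v)
  exact mul_left_cancel₀ hn this

section Order

variable [Lattice E] [IsOrderedAddMonoid E]

/-- `P ≤ Q` means that the generating symmetric forms satisfy `A ≤ B` on positive vectors. -/
instance : PartialOrder (HomogPoly n E) where
  le P Q := ∃ A B, IsFormOf A P ∧ IsFormOf B Q ∧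
    ∀ v : Fin n → E, (∀ i, 0 ≤ v i) → A v ≤ B v
  le_refl P := by
    obtain ⟨A, hA⟩ := P.exists_isFormOf
    exact ⟨A, A, hA, hA, fun _ _ => le_rfl⟩
  le_trans := by
    rintro P Q R ⟨A, B, hA, hB, h1⟩ ⟨B', C, hB', hC, h2⟩
    obtain rfl := hB.unique hB'
    exact ⟨A, C, hA, hC, fun v hv => (h1 v hv).trans (h2 v hv)⟩
  le_antisymm := by
    rintro P Q ⟨A, B, hA, hB, h1⟩ ⟨B', A', hB', hA', h2⟩
    obtain rfl := hB.unique hB'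
    obtain rfl := hA.unique hA'
    have hz : ∀ v : Fin n → E, (∀ i, 0 ≤ v i) → (A - B) v = 0 := fun v hv => by
      simp [le_antisymm (h1 v hv) (h2 v hv)]
    refine DFunLike.ext _ _ fun x => ?_
    rw [hA.2, hB.2, ← sub_eq_zero]
    have hx : (fun _ : Fin n => x) = (fun _ => x⁺) + (fun _ => (-1 : ℝ) • x⁻) := by
      funext i
      simp [← sub_eq_add_neg, posPart_sub_negPart]
    have h3 : (A - B) (fun _ => x) = 0 := by
      rw [hx, ContinuousMultilinearMap.map_add_univ]
      refine Finset.sum_eq_zero fun s _ => ?_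
      have h4 : s.piecewise (fun _ : Fin n => x⁺) (fun _ => (-1 : ℝ) • x⁻)
          = fun i => (if i ∈ s then (1 : ℝ) else -1) • (if i ∈ s then x⁺ else x⁻) := by
        funext i
        by_cases hi : i ∈ s <;> simp [Finset.piecewise, hi]
      rw [h4, ContinuousMultilinearMap.map_smul_univ, hz, smul_zero]
      intro i
      split_ifs
      · exact posPart_nonneg x
      · exact negPart_nonneg x
    simpa using h3

/-- The absolute value `|P|`: the least upper bound of `P` and `-P` in the ordered space of
`n`-homogeneous polynomials (with value `0` if there is none, that is, if `P` is not regular). -/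
def absVal (P : HomogPoly n E) : HomogPoly n E :=
  open Classical in if h : ∃ Q, IsLUB {P, -P} Q then h.choose else 0

end Order

/-- The norm of uniform convergence on the closed unit ball. -/
def supNorm (P : HomogPoly n E) : ℝ := sSup {r | ∃ x : E, ‖x‖ ≤ 1 ∧ r = |P x|}

/-- The regular norm `‖P‖_r = ‖ |P| ‖_∞`. -/
def regularNorm [Lattice E] [IsOrderedAddMonoid E] (P : HomogPoly n E) : ℝ := supNorm (absVal P)

end HomogPoly

variable (n E) in
/-- The orthogonally additive `n`-homogeneous polynomials on `E`, with the linear structure and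
the order of `HomogPoly n E`. -/
def OrthAddPoly [Lattice E] : Submodule ℝ (HomogPoly n E) where
  carrier := {P | ∀ x y : E, |x| ⊓ |y| = 0 → P (x + y) = P x + P y}
  add_mem' := by
    intro P Q hP hQ x y hxy
    simp only [HomogPoly.add_apply, hP x y hxy, hQ x y hxy]
    ring
  zero_mem' := by
    intro x y _
    simp [HomogPoly.zero_apply]
  smul_mem' := by
    intro c P hP x y hxy
    simp only [HomogPoly.smul_apply, hP x y hxy]
    ring

end HomogeneousPolynomials

section Measures

variable (K : Type*) [TopologicalSpace K] [T2Space K] [MeasurableSpace K]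
  [BorelSpace K]

variable {K} in
theorem regular_of_le_regular {ρ σ : Measure K} [IsFiniteMeasure σ] [σ.Regular] (h : ρ ≤ σ) :
    ρ.Regular := by
  have : IsFiniteMeasure ρ := isFiniteMeasure_of_le σ h
  have : ρ.InnerRegularCompactLTTop := by
    refine ⟨?_⟩
    rintro U ⟨hU, hUf⟩ r hr
    obtain ⟨ε, hε, hεr⟩ : ∃ ε : ENNReal, ε ≠ 0 ∧ r + ε ≤ ρ U :=
      ⟨ρ U - r, (tsub_pos_of_lt hr).ne', (add_tsub_cancel_of_le hr.le).le⟩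
    obtain ⟨F, hFU, hF, hlt⟩ := hU.exists_isCompact_sdiff_lt (measure_ne_top σ U) hε
    refine ⟨F, hFU, hF, ?_⟩
    have h1 : ρ U ≤ ρ F + ρ (U \ F) := by
      have h2 := measure_union_le (μ := ρ) F (U \ F)
      rwa [Set.union_sdiff_cancel hFU] at h2
    have h3 : ρ (U \ F) < ε := (h _).trans_lt hlt
    by_contra hle
    rw [not_lt] at hle
    have h4 : ρ F + ρ (U \ F) < r + ε :=
      ENNReal.add_lt_add_of_le_of_lt (measure_ne_top ρ F) hle h3
    exact absurd (hεr.trans h1) (not_le.mpr h4)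
  infer_instance

/-- The space of regular Borel signed measures on `K`; the order is that of signed measures:
`μ ≤ ν` iff `μ B ≤ ν B` for every Borel set `B`. -/
def RegularSignedMeasure : Submodule ℝ (SignedMeasure K) where
  carrier := {μ | μ.totalVariation.Regular}
  add_mem' := by
    intro μ ν hμ hν
    simp only [Set.mem_ofPred_eq] at hμ hν ⊢
    have : (μ.totalVariation + ν.totalVariation).Regular := by infer_instance
    refine regular_of_le_regular (σ := μ.totalVariation + ν.totalVariation) ?_
    simp only [SignedMeasure.totalVariation_eq_variation]
    exact VectorMeasure.variation_add_le
  zero_mem' := by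
    simp only [Set.mem_ofPred_eq, SignedMeasure.totalVariation_zero]
    infer_instance
  smul_mem' := by
    intro c μ hμ
    simp only [Set.mem_ofPred_eq, SignedMeasure.totalVariation_eq_variation] at hμ ⊢
    rw [VectorMeasure.variation_smul]
    exact hμ.smul enorm_ne_top

variable {K}

namespace RegularSignedMeasure

/-- The variation norm `‖μ‖₁ = |μ|(K)`. -/
def variationNorm (μ : RegularSignedMeasure K) : ℝ :=
  (μ : SignedMeasure K).totalVariation.real Set.univ

/-- The norm `‖μ‖₀ = max {‖μ⁺‖₁, ‖μ⁻‖₁}`. -/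
def zeroNorm (μ : RegularSignedMeasure K) : ℝ :=
  max ((μ : SignedMeasure K).toJordanDecomposition.posPart.real Set.univ)
    ((μ : SignedMeasure K).toJordanDecomposition.negPart.real Set.univ)

end RegularSignedMeasure

end Measures

section NormedSpacesAndLattices

variable {V W : Type*} [AddCommGroup V] [Module ℝ V] [AddCommGroup W] [Module ℝ W]

/-- `N` is a norm on the real vector space `V`. -/
structure IsNorm (N : V → ℝ) : Prop where
  eq_zero : ∀ v, N v = 0 → v = 0
  smul : ∀ (c : ℝ) (v : V), N (c • v) = |c| * N v
  add_le : ∀ v w, N (v + w) ≤ N v + N w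

/-- The ordered real vector space `V` is a Banach lattice in the norm `N`. -/
structure IsBanachLattice [PartialOrder V] (N : V → ℝ) : Prop extends IsNorm N where
  add_le_add : ∀ u v w : V, u ≤ v → u + w ≤ v + w
  smul_le_smul : ∀ (c : ℝ) (u v : V), 0 ≤ c → u ≤ v → c • u ≤ c • v
  exists_sup : ∀ u v : V, ∃ s, IsLUB {u, v} s
  exists_inf : ∀ u v : V, ∃ i, IsGLB {u, v} i
  solid : ∀ u v a b : V, IsLUB {u, -u} a → IsLUB {v, -v} b → a ≤ b → N u ≤ N v
  complete : ∀ u : ℕ → V, (∀ ε > 0, ∃ m, ∀ k ≥ m, ∀ l ≥ m, N (u k - u l) < ε) →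
    ∃ v, Tendsto (fun k => N (u k - v)) atTop (𝓝 0)

/-- `J` is an isometric isomorphism of the normed spaces `(V, N)` and `(W, N')`. -/
structure IsIsometricIso (J : V ≃ₗ[ℝ] W) (N : V → ℝ) (N' : W → ℝ) : Prop where
  isNorm_source : IsNorm N
  isNorm_target : IsNorm N'
  norm_eq : ∀ v, N' (J v) = N v

/-- `J` is a Banach lattice isometric isomorphism of `(V, N)` and `(W, N')`: both are Banach
lattices, and the linear bijection `J` preserves the lattice operations and the norms. -/
structure IsBanachLatticeIsometricIso [PartialOrder V] [PartialOrder W] (J : V ≃ₗ[ℝ] W)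
    (N : V → ℝ) (N' : W → ℝ) : Prop extends IsIsometricIso J N N' where
  source : IsBanachLattice N
  target : IsBanachLattice N'
  map_sup : ∀ u v s : V, IsLUB {u, v} s → IsLUB {J u, J v} (J s)
  map_inf : ∀ u v i : V, IsGLB {u, v} i → IsGLB {J u, J v} (J i)

end NormedSpacesAndLattices

end

/-! The map `J` is a composite of two bijections through the dual of `C(K)`: a measure gives the
functional φ of integration (Riesz), and φ gives the polynomial x ↦ φ(xⁿ).

Surjectivity of the second map is the core. Polarization shows that the symmetric form A of an
orthogonally additive polynomial vanishes on a family that splits into two mutually orthogonal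
nonempty parts (`eq_zero_of_split`). Cutting x into thin level strips, only products of pieces from
nearby levels survive. There x is almost constant, so the functions of x in the n slots act as
scalars, and A(G₁∘x, …, Gₙ∘x) depends only on the product of the Gⱼ (`comp_congr`). Moving all
factors into one slot gives A(x, …, x) = A(xⁿ, 1, …, 1), which is linear in xⁿ.

The order and the norms rest on `exists_approx_hahn`: a continuous 0 ≤ h ≤ 1 that nearly equals the
indicator of a positive Hahn set. Positivity of μ is tested on 1 - h. Powers of 2h - 1 for odd n
nearly attain ‖μ‖₁; for even n powers are nonnegative, and powers of h nearly attain only ‖μ⁺‖₁, or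
‖μ⁻‖₁ after a sign change. The functions 2h - 1 also show that |μ| induces the least upper bound of
±P among all homogeneous polynomials (`isLUB_powPoly_toDual`), which identifies the regular norm. -/

noncomputable section

/-! ### Orthogonally additive polynomials are functionals of the n-th power -/

section OrthogonallyAdditive

variable {n : ℕ} {K : Type*} [TopologicalSpace K] [CompactSpace K]

omit [CompactSpace K] in
theorem abs_inf_abs_eq_zero_of_mul_eq_zero {x y : C(K, ℝ)} (h : x * y = 0) : |x| ⊓ |y| = 0 := by
  ext t
  have ht : x t * y t = 0 := congrArg (fun f : C(K, ℝ) => f t) h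
  rcases mul_eq_zero.1 ht with h0 | h0 <;> simp [h0]

/-- The form generating an orthogonally additive polynomial vanishes at families which split into
two mutually orthogonal nonempty subfamilies. -/
theorem HomogPoly.IsFormOf.eq_zero_of_split {P : HomogPoly n C(K, ℝ)}
    {A : ContinuousMultilinearMap ℝ (fun _ : Fin n => C(K, ℝ)) ℝ} (hA : HomogPoly.IsFormOf A P)
    (hP : P ∈ OrthAddPoly n C(K, ℝ)) (w : Fin n → C(K, ℝ)) (I : Fin n → Prop)
    (h : ∀ i j, I i → ¬ I j → w i * w j = 0) {i j : Fin n} (hi : I i) (hj : ¬ I j) : A w = 0 := by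
  classical
  let T : (Fin n → ℝ) →L[ℝ] C(K, ℝ) :=
    ∑ k, (ContinuousLinearMap.proj (R := ℝ) (φ := fun _ : Fin n => ℝ) k).smulRight (w k)
  let π : (Fin n → Prop) → (Fin n → ℝ) →L[ℝ] C(K, ℝ) := fun S =>
    ∑ k, if S k then (ContinuousLinearMap.proj (R := ℝ) (φ := fun _ : Fin n => ℝ) k).smulRight (w k)
      else 0
  have hT : ∀ t, T t = ∑ k, t k • w k := fun t => by simp [T]
  have hπ : ∀ S t, π S t = ∑ k, if S k then t k • w k else 0 := fun S t => by
    simp only [π, _root_.sum_apply]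
    refine Finset.sum_congr rfl fun k _ => ?_
    split_ifs <;> simp
  have hadd : ∀ t, P (T t) = P (π I t) + P (π (fun k => ¬ I k) t) := by
    intro t
    rw [← hP _ _ (abs_inf_abs_eq_zero_of_mul_eq_zero ?_)]
    · congr 1
      rw [hT, hπ, hπ, ← Finset.sum_add_distrib]
      refine Finset.sum_congr rfl fun k _ => ?_
      by_cases hk : I k <;> simp [hk]
    · rw [hπ, hπ, Finset.sum_mul_sum]
      refine Finset.sum_eq_zero fun k _ => Finset.sum_eq_zero fun l _ => ?_
      by_cases hk : I k <;> by_cases hl : I l <;> simp [hk, hl, h]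
  let C (S : (Fin n → ℝ) →L[ℝ] C(K, ℝ)) : ContinuousMultilinearMap ℝ (fun _ : Fin n => Fin n → ℝ) ℝ :=
    A.compContinuousLinearMap fun _ => S
  -- `Q` is the pullback of `P` to ℝⁿ. Orthogonal additivity gives it a second symmetric form,
  -- without mixed terms. Uniqueness equates the two, and at the basis vectors each term of the
  -- second has a zero slot.
  let Q : HomogPoly n (Fin n → ℝ) := ⟨fun t => P (T t), C T, fun t => by simp [C, hA.2]⟩
  have h1 : HomogPoly.IsFormOf (C T) Q :=
    ⟨fun σ v => by
      simpa [C] using hA.1 σ (fun k => T (v k)), fun t => hA.2 (T t)⟩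
  have h2 : HomogPoly.IsFormOf (C (π I) + C (π fun k => ¬ I k)) Q := by
    refine ⟨fun σ v => ?_, fun t => ?_⟩
    · have e1 := hA.1 σ (fun k => π I (v k))
      have e2 := hA.1 σ (fun k => π (fun k => ¬ I k) (v k))
      simp only [C, _root_.add_apply,
        ContinuousMultilinearMap.compContinuousLinearMap_apply, e1, e2]
    · change P (T t) = _
      rw [hadd, hA.2, hA.2]
      rfl
  have h3 := congrArg (fun B => B fun k => Pi.single k (1 : ℝ)) (h1.unique h2)
  have e0 : ∀ k, T (Pi.single k 1) = w k := fun k => by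
    rw [hT, Finset.sum_eq_single k] <;> simp +contextual
  have e1 : π I (Pi.single j 1) = 0 := by
    rw [hπ]
    refine Finset.sum_eq_zero fun k _ => ?_
    by_cases hk : k = j
    · subst hk; simp [hj]
    · simp [hk]
  have e2 : π (fun k => ¬ I k) (Pi.single i 1) = 0 := by
    rw [hπ]
    refine Finset.sum_eq_zero fun k _ => ?_
    by_cases hk : k = i
    · subst hk; simp [hi]
    · simp [hk]
  simp only [C, _root_.add_apply,
    ContinuousMultilinearMap.compContinuousLinearMap_apply, e0] at h3
  rw [h3, A.map_coord_zero j e1, A.map_coord_zero i e2, add_zero]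

/-- Only the tents at ⌊y⌋ and ⌊y⌋ + 1 can be nonzero at y. The index set reaches `N + 1` because ⌊y⌋
may equal `N`. -/
theorem sum_tent_eq_one {N : ℤ} {y : ℝ} (h1 : -(N : ℝ) ≤ y) (h2 : y ≤ N) :
    ∑ i ∈ Finset.Icc (-N) (N + 1), max 0 (1 - |y - i|) = 1 := by
  have hf1 : -N ≤ ⌊y⌋ := Int.le_floor.2 (by push_cast; exact h1)
  have hf2 : ⌊y⌋ ≤ N := Int.cast_le.1 ((Int.floor_le y).trans h2)
  have l1 := Int.floor_le y
  have l2 := Int.lt_floor_add_one y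
  have hsub : ({⌊y⌋, ⌊y⌋ + 1} : Finset ℤ) ⊆ Finset.Icc (-N) (N + 1) := by
    intro i hi
    simp only [Finset.mem_insert, Finset.mem_singleton] at hi
    rw [Finset.mem_Icc]
    omega
  rw [← Finset.sum_subset hsub, Finset.sum_pair (by simp)]
  · push_cast
    rw [abs_of_nonneg (by linarith), abs_of_nonpos (by linarith), max_eq_right (by linarith),
      max_eq_right (by linarith)]
    ring
  · intro i _ hi
    simp only [Finset.mem_insert, Finset.mem_singleton, not_or] at hi
    rcases lt_or_gt_of_ne hi.1 with h | h
    · have : (i : ℝ) + 1 ≤ ⌊y⌋ := by exact_mod_cast h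
      rw [abs_of_nonneg (by linarith), max_eq_left (by linarith)]
    · have h' : ⌊y⌋ + 2 ≤ i := by omega
      have : (⌊y⌋ : ℝ) + 2 ≤ i := by exact_mod_cast h'
      rw [abs_of_nonpos (by linarith), max_eq_left (by linarith)]

/-- A continuous partition of unity subordinate to the level strips of width `δ` of `x`. -/
theorem exists_level_partition (x : C(K, ℝ)) {δ : ℝ} (hδ : 0 < δ) :
    ∃ (s : Finset ℤ) (e : ℤ → C(K, ℝ)), (∀ i t, 0 ≤ e i t) ∧ (∑ i ∈ s, e i = 1) ∧
      (∀ i t, e i t ≠ 0 → |x t - δ * i| ≤ δ) ∧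
      ∀ i j : ℤ, 2 ≤ |i - j| → e i * e j = 0 := by
  obtain ⟨N, hN⟩ := exists_nat_ge (‖x‖ / δ)
  let e : ℤ → C(K, ℝ) := fun i => ⟨fun t => max 0 (1 - |x t / δ - i|), by fun_prop⟩
  have he : ∀ i t, e i t = max 0 (1 - |x t / δ - i|) := fun _ _ => rfl
  have hne : ∀ i t, e i t ≠ 0 → |x t / δ - i| < 1 := fun i t h => by
    by_contra hc
    exact h (by rw [he, max_eq_left]; linarith)
  refine ⟨Finset.Icc (-(N : ℤ)) (N + 1), e, fun i t => le_max_left _ _, ?_, ?_, ?_⟩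
  · ext t
    have hx : |x t / δ| ≤ ((N : ℤ) : ℝ) := by
      rw [abs_div, abs_of_pos hδ]
      refine le_trans ?_ (by exact_mod_cast hN)
      gcongr
      exact x.norm_coe_le_norm t
    rw [abs_le] at hx
    simpa [ContinuousMap.sum_apply, he] using sum_tent_eq_one hx.1 hx.2
  · intro i t h
    have h1 := hne i t h
    have : x t - δ * i = δ * (x t / δ - i) := by field_simp
    rw [this, abs_mul, abs_of_pos hδ]
    nlinarith
  · intro i j hij
    ext t
    by_contra hc
    simp only [ContinuousMap.mul_apply, ContinuousMap.zero_apply, mul_eq_zero, not_or] at hc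
    have h1 := hne i t hc.1
    have h2 := hne j t hc.2
    have h3 : (2 : ℝ) ≤ |(i : ℝ) - j| := by exact_mod_cast hij
    have h4 : (i : ℝ) - j = (x t / δ - j) - (x t / δ - i) := by ring
    have h5 := abs_sub (x t / δ - j) (x t / δ - i)
    rw [← h4] at h5
    linarith

theorem Int.add_one_ediv_eq {M k : ℤ} (hM : 0 < M) (h : ¬ M ∣ k + 1) : (k + 1) / M = k / M := by
  have h1 := Int.emod_nonneg k hM.ne'
  have h2 := Int.emod_lt_of_pos k hM
  have h3 := Int.mul_ediv_add_emod k M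
  rcases lt_or_ge (k % M + 1) M with h4 | h4
  · exact ((Int.ediv_emod_unique hM).2 ⟨by omega, by omega, h4⟩ : (k + 1) / M = k / M ∧
      (k + 1) % M = k % M + 1).1
  · exact absurd ⟨k / M + 1, by rw [mul_add]; omega⟩ h

/-- Neighbouring blocks of length `M` are separated by a multiple of `M`, which neither `k` nor `l`
may occupy. -/
theorem Int.two_le_abs_sub_of_ediv_ne {M k l : ℤ} (hM : 0 < M) (hk : ¬ M ∣ k) (hl : ¬ M ∣ l)
    (h : k / M ≠ l / M) : 2 ≤ |k - l| := by
  by_contra hc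
  rw [not_le, abs_lt] at hc
  have : k = l ∨ k = l + 1 ∨ l = k + 1 := by omega
  rcases this with rfl | rfl | rfl
  · exact h rfl
  · exact h (Int.add_one_ediv_eq hM hk)
  · exact h (Int.add_one_ediv_eq hM hl).symm

/-- Two functions of `x`, discretized in `n` slots along a family of strips which misses a residue
class, have the same value under the form as soon as their products agree. -/
theorem HomogPoly.IsFormOf.discretized_eq {P : HomogPoly n C(K, ℝ)}
    {A : ContinuousMultilinearMap ℝ (fun _ : Fin n => C(K, ℝ)) ℝ} (hA : HomogPoly.IsFormOf A P)
    (hP : P ∈ OrthAddPoly n C(K, ℝ)) {e : ℤ → C(K, ℝ)}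
    (he : ∀ i j : ℤ, 2 ≤ |i - j| → e i * e j = 0) (S : Fin n → Finset ℤ) (b : ℤ → ℤ)
    (hb : ∀ j j' : Fin n, ∀ i ∈ S j, ∀ i' ∈ S j', b i ≠ b i' → 2 ≤ |i - i'|)
    (G H : ℤ → Fin n → ℝ) (hGH : ∀ k, ∏ j, G k j = ∏ j, H k j) :
    A (fun j => ∑ i ∈ S j, G (b i) j • e i) = A (fun j => ∑ i ∈ S j, H (b i) j • e i) := by
  classical
  rw [A.map_sum_finset, A.map_sum_finset]
  refine Finset.sum_congr rfl fun r hr => ?_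
  rw [Fintype.mem_piFinset] at hr
  rw [A.map_smul_univ, A.map_smul_univ]
  -- If all chosen strips lie in one block, the scalars multiply to the common product. Otherwise
  -- the strips of one block are orthogonal to the rest, and the form vanishes.
  by_cases hc : ∀ j j', b (r j) = b (r j')
  · congr 1
    rcases isEmpty_or_nonempty (Fin n) with h0 | ⟨⟨j0⟩⟩
    · simp
    · simp only [hc _ j0, hGH]
  · push Not at hc
    obtain ⟨j, j', hjj⟩ := hc
    rw [hA.eq_zero_of_split hP (fun j => e (r j)) (fun k => b (r k) = b (r j))
      (fun k l hk hl => he _ _ (hb k l _ (hr k) _ (hr l) (by rw [hk]; exact Ne.symm hl)))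
      (i := j) (j := j') rfl hjj.symm]
    simp

/-- Group the strips by residue modulo n + 1. After expanding each slot over the residues, the n
slots use at most n of the n + 1 classes, so some class `q` is missed. The remaining strips fall
into blocks between consecutive members of that class, and distinct blocks are orthogonal. On each
block x is nearly constant, so `discretized_eq` applies up to a small error. -/
theorem HomogPoly.IsFormOf.comp_congr {P : HomogPoly n C(K, ℝ)}
    {A : ContinuousMultilinearMap ℝ (fun _ : Fin n => C(K, ℝ)) ℝ} (hA : HomogPoly.IsFormOf A P)
    (hP : P ∈ OrthAddPoly n C(K, ℝ)) (x : C(K, ℝ)) (G H : Fin n → C(ℝ, ℝ))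
    (hGH : ∀ y, ∏ j, G j y = ∏ j, H j y) :
    A (fun j => (G j).comp x) = A (fun j => (H j).comp x) := by
  classical
  have hn : (0 : ℝ) < n + 1 := by positivity
  obtain ⟨D, hD0, hD⟩ : ∃ D : ℝ, 0 ≤ D ∧ ∀ F ∈ ({G, H} : Set (Fin n → C(ℝ, ℝ))),
      ∀ j, ‖(F j).comp x‖ ≤ D := by
    refine ⟨∑ j, ‖(G j).comp x‖ + ∑ j, ‖(H j).comp x‖, by positivity, fun F hF j => ?_⟩
    have h1 : ∀ F : Fin n → C(ℝ, ℝ), ‖(F j).comp x‖ ≤ ∑ j, ‖(F j).comp x‖ := fun F =>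
      Finset.single_le_sum (f := fun j => ‖(F j).comp x‖) (fun _ _ => norm_nonneg _)
        (Finset.mem_univ j)
    have h2 : ∀ F : Fin n → C(ℝ, ℝ), 0 ≤ ∑ j, ‖(F j).comp x‖ := fun F => by positivity
    rcases hF with rfl | rfl
    · linarith [h1 F, h2 H]
    · linarith [h1 F, h2 G]
  -- The Lipschitz constant of `A` on arguments of norm at most D + 1; the extra 1 leaves room for
  -- an approximation error η ≤ 1.
  set Z : ℝ := ‖A‖ * n * (D + 1) ^ (n - 1) with hZ
  have hZ0 : 0 ≤ Z := by positivity
  -- the two values differ by at most a multiple of `η`, for every small `η`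
  suffices key : ∀ η : ℝ, 0 < η → η ≤ 1 → |A (fun j => (G j).comp x) - A (fun j => (H j).comp x)|
      ≤ ((Fintype.card (Fin n → ZMod (n + 1)) : ℝ) * (2 * Z)) * η by
    rw [← sub_eq_zero, ← abs_nonpos_iff]
    set c := (Fintype.card (Fin n → ZMod (n + 1)) : ℝ) * (2 * Z)
    have hc : 0 ≤ c := by positivity
    refine le_of_forall_pos_le_add fun ε hε => ?_
    refine (key (min 1 (ε / (c + 1))) (by positivity) (min_le_left _ _)).trans ?_
    calc c * min 1 (ε / (c + 1)) ≤ c * (ε / (c + 1)) := by gcongr; exact min_le_right _ _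
      _ ≤ (c + 1) * (ε / (c + 1)) := by gcongr; linarith
      _ = 0 + ε := by field_simp; ring
  intro η hη hη1
  obtain ⟨d, hd, hd1, hunif⟩ : ∃ d : ℝ, 0 < d ∧ d ≤ 1 ∧ ∀ F ∈ ({G, H} : Set (Fin n → C(ℝ, ℝ))),
      ∀ j, ∀ y z : ℝ, |y| ≤ ‖x‖ + 1 → |z| ≤ ‖x‖ + 1 → |y - z| ≤ d → |F j y - F j z| ≤ η := by
    let F : ℝ → (Fin n → ℝ) × (Fin n → ℝ) := fun y => (fun j => G j y, fun j => H j y)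
    have hF : Continuous F := by fun_prop
    have hu := (isCompact_Icc (a := -(‖x‖ + 1)) (b := ‖x‖ + 1)).uniformContinuousOn_of_continuous
      hF.continuousOn
    obtain ⟨d, hd, h⟩ := Metric.uniformContinuousOn_iff_le.1 hu η hη
    refine ⟨min d 1, by positivity, min_le_right _ _, fun F' hF' j y z hy hz hyz => ?_⟩
    have h1 := h y (abs_le.1 hy) z (abs_le.1 hz) (hyz.trans (min_le_left _ _))
    rw [Prod.dist_eq, max_le_iff, dist_pi_le_iff hη.le, dist_pi_le_iff hη.le] at h1
    rcases hF' with rfl | rfl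
    · exact h1.1 j
    · exact h1.2 j
  -- On a strip, x is within δ of δi, and δi is within (n + 1)δ of the base point of its block: n +
  -- 2 widths in all.
  set δ : ℝ := d / (n + 2) with hδ
  have hδ0 : 0 < δ := by positivity
  obtain ⟨s, e, he0, hsum, hsupp, hdisj⟩ := exists_level_partition x hδ0
  let u : ZMod (n + 1) → C(K, ℝ) := fun ρ => ∑ i ∈ s with ((i : ℤ) : ZMod (n + 1)) = ρ, e i
  have hu : ∑ ρ, u ρ = 1 := by rw [← hsum]; exact Finset.sum_fiberwise _ _ _
  have hu1 : ∀ ρ t, ∑ i ∈ s with ((i : ℤ) : ZMod (n + 1)) = ρ, e i t ≤ 1 := fun ρ t => by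
    have h1 : ∑ i ∈ s, e i t = 1 := by
      simpa [ContinuousMap.sum_apply] using congrArg (fun f : C(K, ℝ) => f t) hsum
    rw [← h1]
    exact Finset.sum_le_sum_of_subset_of_nonneg (Finset.filter_subset _ _) fun i _ _ => he0 i t
  have hexp : ∀ f : Fin n → C(K, ℝ),
      A f = ∑ r : Fin n → ZMod (n + 1), A (fun j => f j * u (r j)) := fun f => by
    rw [← A.map_sum fun j ρ => f j * u ρ]
    simp [← Finset.mul_sum, hu]
  rw [hexp, hexp, ← Finset.sum_sub_distrib]
  refine (Finset.abs_sum_le_sum_abs _ _).trans ?_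
  rw [← nsmul_eq_mul, smul_mul_assoc]
  refine Finset.sum_le_card_nsmul _ _ _ fun r _ => ?_
  obtain ⟨q, hq⟩ : ∃ q, ∀ j, r j ≠ q := by
    by_contra! hc
    have := Fintype.card_le_of_surjective r hc
    simp [ZMod.card] at this
  let M : ℤ := n + 1
  have hM : 0 < M := by positivity
  -- `b i` is the number of the block containing strip `i`, and `c k` is the level at the left end
  -- of block `k`.
  let b : ℤ → ℤ := fun i => (i - q.val) / M
  let c : ℤ → ℝ := fun k => δ * (q.val + M * k : ℤ)
  let S : Fin n → Finset ℤ := fun j => {i ∈ s | (i : ZMod (n + 1)) = r j}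
  have hdvd : ∀ j, ∀ i ∈ S j, ¬ M ∣ i - q.val := by
    intro j i hi hc
    have h1 : (((n + 1 : ℕ) : ℤ)) ∣ i - (q.val : ℤ) := by exact_mod_cast hc
    rw [← ZMod.intCast_zmod_eq_zero_iff_dvd] at h1
    push_cast at h1
    rw [ZMod.natCast_zmod_val, sub_eq_zero] at h1
    exact hq j ((Finset.mem_filter.1 hi).2 ▸ h1)
  have hdisc := fun F F' : ℤ → Fin n → ℝ => hA.discretized_eq hP hdisj S b
    (fun j j' i hi i' hi' hne => by
      simpa using Int.two_le_abs_sub_of_ediv_ne hM (hdvd j i hi) (hdvd j' i' hi') hne) F F'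
  have hc : ∀ i t, e i t ≠ 0 → |x t - c (b i)| ≤ d := by
    intro i t h
    have h1 := hsupp i t h
    have h2 : (i : ℤ) - (q.val + M * b i) = (i - q.val) % M := by
      have := Int.mul_ediv_add_emod (i - q.val) M
      simp only [b]
      linarith
    have h3 : |((i - (q.val + M * b i) : ℤ) : ℝ)| ≤ n + 1 := by
      rw [h2, abs_of_nonneg (by exact_mod_cast Int.emod_nonneg _ hM.ne')]
      exact_mod_cast (Int.emod_lt_of_pos (i - q.val) hM).le
    have h4 : x t - c (b i) = (x t - δ * i) + δ * ((i - (q.val + M * b i) : ℤ) : ℝ) := by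
      simp only [c]; push_cast; ring
    rw [h4]
    refine (abs_add_le _ _).trans ?_
    rw [abs_mul, abs_of_pos hδ0]
    calc _ ≤ δ + δ * (n + 1) := by gcongr
      _ = d := by rw [hδ]; field_simp; ring
  have hclose : ∀ F ∈ ({G, H} : Set (Fin n → C(ℝ, ℝ))), ∀ j,
      ‖(F j).comp x * u (r j) - ∑ i ∈ S j, F j (c (b i)) • e i‖ ≤ η := by
    intro F hF j
    rw [ContinuousMap.norm_le _ hη.le]
    intro t
    have h1 : ((F j).comp x * u (r j) - ∑ i ∈ S j, F j (c (b i)) • e i) t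
        = ∑ i ∈ S j, (F j (x t) - F j (c (b i))) * e i t := by
      simp [u, S, ContinuousMap.sum_apply, Finset.mul_sum, sub_mul]
    rw [h1, Real.norm_eq_abs]
    refine (Finset.abs_sum_le_sum_abs _ _).trans ?_
    calc _ ≤ ∑ i ∈ S j, η * e i t := Finset.sum_le_sum fun i _ => by
            rw [abs_mul, abs_of_nonneg (he0 i t)]
            by_cases h0 : e i t = 0
            · simp [h0]
            · have h2 := hc i t h0
              have hx : |x t| ≤ ‖x‖ := x.norm_coe_le_norm t
              have h3 : |c (b i)| ≤ ‖x‖ + 1 := by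
                have := abs_sub_abs_le_abs_sub (c (b i)) (x t)
                rw [abs_sub_comm] at this
                linarith
              exact mul_le_mul_of_nonneg_right (hunif F hF j _ _ (by linarith) h3 h2) (he0 i t)
      _ ≤ η := by
            rw [← Finset.mul_sum]
            exact mul_le_of_le_one_right hη.le (hu1 _ t)
  have hnorm : ∀ F ∈ ({G, H} : Set (Fin n → C(ℝ, ℝ))), ∀ j, ‖(F j).comp x * u (r j)‖ ≤ D := by
    intro F hF j
    refine (norm_mul_le _ _).trans ?_
    refine (mul_le_of_le_one_right (norm_nonneg _) ?_).trans (hD F hF j)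
    rw [ContinuousMap.norm_le _ zero_le_one]
    intro t
    simp only [u, ContinuousMap.sum_apply]
    rw [Real.norm_of_nonneg (Finset.sum_nonneg fun i _ => he0 i t)]
    exact hu1 _ t
  have hest : ∀ F ∈ ({G, H} : Set (Fin n → C(ℝ, ℝ))),
      |A (fun j => (F j).comp x * u (r j)) - A (fun j => ∑ i ∈ S j, F j (c (b i)) • e i)|
        ≤ Z * η := by
    intro F hF
    refine (A.norm_image_sub_le _ _).trans ?_
    rw [hZ, Fintype.card_fin]
    gcongr
    · refine max_le ?_ ?_
      · exact (pi_norm_le_iff_of_nonneg (by positivity)).2 fun j => by linarith [hnorm F hF j]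
      · refine (pi_norm_le_iff_of_nonneg (by positivity)).2 fun j => ?_
        have h1 := hclose F hF j
        have h2 := hnorm F hF j
        have h3 := norm_sub_norm_le (∑ i ∈ S j, F j (c (b i)) • e i) ((F j).comp x * u (r j))
        rw [norm_sub_rev] at h3
        linarith
    · exact (pi_norm_le_iff_of_nonneg hη.le).2 fun j => hclose F hF j
  have hG := hest G (by simp)
  have hH := hest H (by simp)
  rw [hdisc (fun k j => G j (c k)) (fun k j => H j (c k)) fun k => hGH _] at hG
  rw [abs_sub_comm] at hH
  refine (abs_sub_le _ _ _).trans ((add_le_add hG hH).trans ?_)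
  linarith

/-- An orthogonally additive polynomial is a linear functional of the power. -/
theorem OrthAddPoly.exists_eq_pow (hn : n ≠ 0) {P : HomogPoly n C(K, ℝ)}
    (hP : P ∈ OrthAddPoly n C(K, ℝ)) : ∃ φ : StrongDual ℝ C(K, ℝ), ∀ x, P x = φ (x ^ n) := by
  classical
  obtain ⟨A, hA⟩ := P.exists_isFormOf
  let j0 : Fin n := ⟨0, Nat.pos_of_ne_zero hn⟩
  refine ⟨A.toContinuousLinearMap (fun _ => 1) j0, fun x => ?_⟩
  have h := hA.comp_congr hP x (fun _ => ContinuousMap.id ℝ)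
    (Function.update (fun _ => 1) j0 ((ContinuousMap.id ℝ) ^ n)) fun y => by
      refine Eq.trans ?_ (Finset.prod_eq_single j0 (fun j _ hj => by simp [hj]) (by simp)).symm
      simp
  rw [hA.2]
  refine h.trans (congrArg A (funext fun j => ?_))
  by_cases hj : j = j0
  · subst hj
    ext t
    simp
  · ext t
    simp [hj]

end OrthogonallyAdditive

/-! ### Order and bijectivity for the polynomials φ(xⁿ) -/

section PowerPolynomials

variable {n : ℕ} {K : Type*} [TopologicalSpace K] [CompactSpace K]

/-- The symmetric form `(v₁, …, vₙ) ↦ φ (v₁ ⋯ vₙ)`. -/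
def powForm (n : ℕ) (φ : StrongDual ℝ C(K, ℝ)) :
    ContinuousMultilinearMap ℝ (fun _ : Fin n => C(K, ℝ)) ℝ :=
  φ.compContinuousMultilinearMap (ContinuousMultilinearMap.mkPiAlgebra ℝ (Fin n) C(K, ℝ))

theorem powForm_apply (φ : StrongDual ℝ C(K, ℝ)) (v : Fin n → C(K, ℝ)) :
    powForm n φ v = φ (∏ i, v i) := rfl

/-- The orthogonally additive polynomial `x ↦ φ (x ^ n)`. -/
def powPoly (n : ℕ) [NeZero n] : StrongDual ℝ C(K, ℝ) →ₗ[ℝ] OrthAddPoly n C(K, ℝ) where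
  toFun φ := ⟨⟨fun x => φ (x ^ n), powForm n φ, fun x => by simp [powForm_apply]⟩, by
    intro x y hxy
    change φ ((x + y) ^ n) = φ (x ^ n) + φ (y ^ n)
    rw [← map_add]
    congr 1
    ext t
    have ht : min |x t| |y t| = 0 := congrArg (fun f : C(K, ℝ) => f t) hxy
    rcases min_choice |x t| |y t| with h | h <;> rw [h, abs_eq_zero] at ht <;>
      simp [ht, NeZero.ne n]⟩
  map_add' _ _ := rfl
  map_smul' _ _ := rfl

variable [NeZero n]

theorem powPoly_apply (φ : StrongDual ℝ C(K, ℝ)) (x : C(K, ℝ)) :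
    (powPoly n φ : HomogPoly n C(K, ℝ)) x = φ (x ^ n) := rfl

theorem isFormOf_powPoly (φ : StrongDual ℝ C(K, ℝ)) :
    HomogPoly.IsFormOf (powForm n φ) (powPoly n φ : HomogPoly n C(K, ℝ)) :=
  ⟨fun σ v => by rw [powForm_apply, powForm_apply, Equiv.prod_comp σ v],
    fun x => by simp [powForm_apply, powPoly_apply]⟩

omit [CompactSpace K] [NeZero n] in
theorem prod_update_one (f : C(K, ℝ)) (j : Fin n) :
    ∏ i, Function.update (fun _ : Fin n => (1 : C(K, ℝ))) j f i = f := by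
  rw [Finset.prod_eq_single j (fun i _ hi => by simp [hi]) (by simp)]
  simp

/-- Placing f in one slot and 1 in the others recovers φ f from the form; conversely, a product of
positive functions is positive. -/
theorem powPoly_le_iff {φ ψ : StrongDual ℝ C(K, ℝ)} :
    powPoly n φ ≤ powPoly n ψ ↔ ∀ f : C(K, ℝ), 0 ≤ f → φ f ≤ ψ f := by
  constructor
  · rintro ⟨A, B, hA, hB, h⟩ f hf
    obtain rfl := hA.unique (isFormOf_powPoly φ)
    obtain rfl := hB.unique (isFormOf_powPoly ψ)
    have h1 := h (Function.update (fun _ => 1) 0 f) fun i => by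
      by_cases hi : i = 0
      · subst hi; simp [hf]
      · simp [hi]
    rwa [powForm_apply, powForm_apply, prod_update_one] at h1
  · intro h
    exact ⟨_, _, isFormOf_powPoly φ, isFormOf_powPoly ψ, fun v hv =>
      h _ (Finset.prod_nonneg fun i _ => hv i)⟩

theorem powPoly_bijective : Function.Bijective (powPoly n (K := K)) := by
  constructor
  · intro φ ψ h
    have h1 := (isFormOf_powPoly φ).unique (h ▸ isFormOf_powPoly ψ)
    ext f
    have h2 := congrArg (fun A => A (Function.update (fun _ => 1) 0 f)) h1
    simpa only [powForm_apply, prod_update_one] using h2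
  · rintro ⟨P, hP⟩
    obtain ⟨φ, hφ⟩ := OrthAddPoly.exists_eq_pow (NeZero.ne n) hP
    exact ⟨φ, Subtype.ext (DFunLike.ext _ _ fun x => (hφ x).symm)⟩

end PowerPolynomials

/-! ### Decomposition and representation of functionals on C(K) -/

section PositiveFunctionals

variable {K : Type*} [TopologicalSpace K] [CompactSpace K]

/-- A bounded functional on `C(K)` is a difference of positive ones.  Both are found at once by
extending `(f, -f) ↦ φ f` to `C(K) × C(K)` below `(a, b) ↦ ‖φ‖ * ‖a⁺ + b⁺‖`. -/
theorem exists_positive_sub_eq (φ : StrongDual ℝ C(K, ℝ)) :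
    ∃ ψ₁ ψ₂ : C(K, ℝ) →ₗ[ℝ] ℝ, (∀ f, 0 ≤ f → 0 ≤ ψ₁ f) ∧ (∀ f, 0 ≤ f → 0 ≤ ψ₂ f) ∧
      ∀ f, φ f = ψ₁ f - ψ₂ f := by
  let N : C(K, ℝ) × C(K, ℝ) → ℝ := fun p => ‖φ‖ * ‖p.1⁺ + p.2⁺‖
  let D : C(K, ℝ) × C(K, ℝ) →ₗ.[ℝ] ℝ :=
    ((φ : C(K, ℝ) →ₗ[ℝ] ℝ) ∘ₗ LinearMap.fst ℝ C(K, ℝ) C(K, ℝ)).toPMap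
      (LinearMap.ker (LinearMap.fst ℝ C(K, ℝ) C(K, ℝ) + LinearMap.snd ℝ C(K, ℝ) C(K, ℝ)))
  have hpos : ∀ (f : C(K, ℝ)) (t : K), f⁺ t = max (f t) 0 := fun _ _ => rfl
  have hsolid : ∀ a b : C(K, ℝ), (∀ t, |a t| ≤ |b t|) → ‖a‖ ≤ ‖b‖ := fun a b hab =>
    (ContinuousMap.norm_le _ (norm_nonneg _)).2 fun t => (hab t).trans (b.norm_coe_le_norm t)
  obtain ⟨g, hg, hgN⟩ := exists_extension_of_le_sublinear D N
    (fun c hc p => by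
      have h1 : ∀ a : C(K, ℝ), (c • a)⁺ = c • a⁺ := fun a => by
        ext t
        simp [hpos, mul_max_of_nonneg, hc.le]
      simp only [N, Prod.smul_fst, Prod.smul_snd, h1, ← smul_add, norm_smul,
        Real.norm_of_nonneg hc.le]
      ring)
    (fun p q => by
      simp only [N, ← mul_add]
      gcongr
      refine le_trans (hsolid _ _ fun t => ?_) (norm_add_le _ _)
      simp only [ContinuousMap.add_apply, hpos, Prod.fst_add, Prod.snd_add]
      rw [abs_of_nonneg (by positivity), abs_of_nonneg (by positivity)]
      grind)
    (fun p => by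
      obtain ⟨⟨a, b⟩, hab⟩ := p
      have hb : b = -a := (neg_eq_of_add_eq_zero_right hab).symm
      subst hb
      change φ a ≤ ‖φ‖ * ‖a⁺ + (-a)⁺‖
      refine ((le_abs_self _).trans (φ.le_opNorm a)).trans ?_
      gcongr
      refine hsolid _ _ fun t => ?_
      simp only [ContinuousMap.add_apply, hpos, ContinuousMap.neg_apply]
      grind)
  have hN0 : ∀ f : C(K, ℝ), 0 ≤ f → (-f)⁺ = 0 := fun f hf => posPart_eq_zero.2 (neg_nonpos.2 hf)
  refine ⟨g ∘ₗ LinearMap.inl ℝ _ _, g ∘ₗ LinearMap.inr ℝ _ _, fun f hf => ?_, fun f hf => ?_,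
    fun f => ?_⟩
  -- The sublinear bound is 0 at (-f, 0) when f ≥ 0, which forces `g (f, 0)` to be nonnegative.
  · have h1 := hgN (-f, 0)
    have h2 : g (-f, 0) = - g (f, 0) := by rw [← map_neg]; simp
    simp only [N, hN0 f hf, posPart_zero, add_zero, norm_zero, mul_zero, h2] at h1
    simpa using h1
  · have h1 := hgN (0, -f)
    have h2 : g (0, -f) = - g (0, f) := by rw [← map_neg]; simp
    simp only [N, hN0 f hf, posPart_zero, add_zero, norm_zero, mul_zero, h2] at h1
    simpa using h1
  · have h1 : g (f, -f) = φ f := hg ⟨(f, -f), by simp [D]⟩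
    have h2 : g (f, -f) = g (f, 0) - g (0, f) := by rw [← map_sub]; simp
    simp [← h1, h2]

theorem exists_regular_measure_eq [T2Space K] [MeasurableSpace K] [BorelSpace K]
    (ψ : C(K, ℝ) →ₗ[ℝ] ℝ) (hψ : ∀ f, 0 ≤ f → 0 ≤ ψ f) :
    ∃ ρ : Measure K, ρ.Regular ∧ IsFiniteMeasure ρ ∧ ∀ f : C(K, ℝ), ψ f = ∫ t, f t ∂ρ := by
  let Λ : CompactlySupportedContinuousMap K ℝ →ₚ[ℝ] ℝ :=
  { toFun g := ψ g.toContinuousMap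
    map_add' g g' := ψ.map_add _ _
    map_smul' c g := ψ.map_smul _ _
    monotone' g g' h := by
      have h1 := hψ (g'.toContinuousMap - g.toContinuousMap) (sub_nonneg.2 h)
      rw [map_sub] at h1
      exact sub_nonneg.1 h1 }
  exact ⟨RealRMK.rieszMeasure Λ, inferInstance, inferInstance, fun f =>
    (RealRMK.integral_rieszMeasure Λ ⟨f, HasCompactSupport.of_compactSpace _⟩).symm⟩

end PositiveFunctionals

/-! ### The lattice of regular signed measures -/

namespace RegularSignedMeasure

variable {K : Type*} [TopologicalSpace K] [T2Space K] [MeasurableSpace K] [BorelSpace K]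

/-- The positive part of the Jordan decomposition. -/
abbrev posMeasure (μ : RegularSignedMeasure K) : Measure K :=
  (μ : SignedMeasure K).toJordanDecomposition.posPart

/-- The negative part of the Jordan decomposition. -/
abbrev negMeasure (μ : RegularSignedMeasure K) : Measure K :=
  (μ : SignedMeasure K).toJordanDecomposition.negPart

theorem totalVariation_eq (μ : RegularSignedMeasure K) :
    (μ : SignedMeasure K).totalVariation = posMeasure μ + negMeasure μ := rfl

instance (μ : RegularSignedMeasure K) : (μ : SignedMeasure K).totalVariation.Regular := μ.2

instance (μ : RegularSignedMeasure K) : (posMeasure μ).Regular :=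
  regular_of_le_regular (σ := (μ : SignedMeasure K).totalVariation) (Measure.le_add_right le_rfl)

instance (μ : RegularSignedMeasure K) : (negMeasure μ).Regular :=
  regular_of_le_regular (σ := (μ : SignedMeasure K).totalVariation) (Measure.le_add_left le_rfl)

/-- A finite regular measure as a regular signed measure. -/
def ofMeasure (ρ : Measure K) [IsFiniteMeasure ρ] [ρ.Regular] : RegularSignedMeasure K :=
  ⟨ρ.toSignedMeasure, by
    change (ρ.toSignedMeasure.totalVariation).Regular
    rw [SignedMeasure.totalVariation_eq_variation, Measure.variation_toSignedMeasure]
    infer_instance⟩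

theorem le_iff {μ ν : RegularSignedMeasure K} : μ ≤ ν ↔ ∀ B, MeasurableSet B →
    (μ : SignedMeasure K) B ≤ (ν : SignedMeasure K) B := VectorMeasure.le_iff

theorem ofMeasure_apply (ρ : Measure K) [IsFiniteMeasure ρ] [ρ.Regular] {B : Set K}
    (hB : MeasurableSet B) : (ofMeasure ρ : SignedMeasure K) B = ρ.real B :=
  Measure.toSignedMeasure_apply_measurable hB

theorem apply_eq (μ : RegularSignedMeasure K) {B : Set K} (hB : MeasurableSet B) :
    (μ : SignedMeasure K) B = (posMeasure μ).real B - (negMeasure μ).real B :=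
  SignedMeasure.apply_eq_posPart_real_sub_negPart_real _ hB

theorem eq_sub (μ : RegularSignedMeasure K) : μ = ofMeasure (posMeasure μ) - ofMeasure (negMeasure μ) :=
  Subtype.ext (SignedMeasure.toSignedMeasure_toJordanDecomposition _).symm

/-- Hahn decomposition. -/
theorem exists_hahn (μ : RegularSignedMeasure K) : ∃ S, MeasurableSet S ∧ posMeasure μ Sᶜ = 0 ∧
    negMeasure μ S = 0 ∧ ∀ B, MeasurableSet B → (posMeasure μ).real B = (μ : SignedMeasure K) (B ∩ S) ∧
      (negMeasure μ).real B = - (μ : SignedMeasure K) (B ∩ Sᶜ) := by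
  obtain ⟨T, hT, h1, h2⟩ := (μ : SignedMeasure K).toJordanDecomposition.mutuallySingular
  refine ⟨Tᶜ, hT.compl, by rwa [compl_compl], h2, fun B hB => ?_⟩
  rw [compl_compl, apply_eq μ (hB.inter hT.compl), apply_eq μ (hB.inter hT)]
  have e1 : (negMeasure μ).real (B ∩ Tᶜ) = 0 := by
    rw [measureReal_def, measure_mono_null Set.inter_subset_right h2, ENNReal.toReal_zero]
  have e2 : (posMeasure μ).real (B ∩ T) = 0 := by
    rw [measureReal_def, measure_mono_null Set.inter_subset_right h1, ENNReal.toReal_zero]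
  have e3 := measureReal_inter_add_sdiff (μ := posMeasure μ) (s := B) hT
  have e4 := measureReal_inter_add_sdiff (μ := negMeasure μ) (s := B) hT
  rw [Set.sdiff_eq] at e3 e4
  constructor <;> linarith

omit [TopologicalSpace K] [T2Space K] [BorelSpace K] in
theorem apply_inter_add_inter_compl (ν : SignedMeasure K) {B S : Set K} (hB : MeasurableSet B)
    (hS : MeasurableSet S) : ν (B ∩ S) + ν (B ∩ Sᶜ) = ν B := by
  rw [← VectorMeasure.of_union (Set.disjoint_left.2 fun t h1 h2 => h2.2 h1.2) (hB.inter hS)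
    (hB.inter hS.compl), Set.inter_union_compl]

/-- On a positive Hahn set an upper bound dominates μ, whose value there is that of μ⁺; off it, the
bound dominates 0, the value of μ⁺ there. -/
theorem isLUB_zero (μ : RegularSignedMeasure K) : IsLUB {μ, 0} (ofMeasure (posMeasure μ)) := by
  constructor
  · rintro ν (rfl | rfl) <;> rw [le_iff] <;> intro B hB <;> rw [ofMeasure_apply _ hB]
    · rw [apply_eq _ hB]
      exact sub_le_self _ measureReal_nonneg
    · exact measureReal_nonneg
  · intro ν hν
    have h1 := le_iff.1 (hν (show μ ∈ _ by simp))
    have h2 := le_iff.1 (hν (show 0 ∈ _ by simp))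
    rw [le_iff]
    intro B hB
    obtain ⟨S, hS, -, -, h⟩ := exists_hahn μ
    rw [ofMeasure_apply _ hB, (h B hB).1, ← apply_inter_add_inter_compl ν.1 hB hS]
    have h3 := h1 _ (hB.inter hS)
    have h4 : 0 ≤ (ν : SignedMeasure K) (B ∩ Sᶜ) := h2 _ (hB.inter hS.compl)
    linarith

theorem isLUB_neg (μ : RegularSignedMeasure K) :
    IsLUB {μ, -μ} (ofMeasure (posMeasure μ) + ofMeasure (negMeasure μ)) := by
  have happ : ∀ B, MeasurableSet B →
      ((ofMeasure (posMeasure μ) + ofMeasure (negMeasure μ) : RegularSignedMeasure K) :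
        SignedMeasure K) B = (posMeasure μ).real B + (negMeasure μ).real B := fun B hB => by
    rw [← ofMeasure_apply _ hB, ← ofMeasure_apply _ hB]
    rfl
  have hneg : ∀ B, ((-μ : RegularSignedMeasure K) : SignedMeasure K) B
      = -((μ : SignedMeasure K) B) := fun _ => rfl
  constructor
  · rintro ν (rfl | rfl) <;> rw [le_iff] <;> intro B hB <;> rw [happ B hB]
    · rw [apply_eq _ hB]
      linarith [measureReal_nonneg (μ := negMeasure ν) (s := B)]
    · rw [hneg, apply_eq _ hB]
      linarith [measureReal_nonneg (μ := posMeasure μ) (s := B)]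
  · intro ν hν
    have h1 := le_iff.1 (hν (show μ ∈ _ by simp))
    have h2 := le_iff.1 (hν (show -μ ∈ _ by simp))
    rw [le_iff]
    intro B hB
    obtain ⟨S, hS, -, -, h⟩ := exists_hahn μ
    rw [happ B hB, (h B hB).1, (h B hB).2, ← apply_inter_add_inter_compl ν.1 hB hS]
    have h3 := h1 _ (hB.inter hS)
    have h4 := h2 _ (hB.inter hS.compl)
    rw [hneg] at h4
    linarith

/-- The absolute value `|μ| = μ⁺ + μ⁻`. -/
def absMeasure (μ : RegularSignedMeasure K) : RegularSignedMeasure K :=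
  ofMeasure (posMeasure μ) + ofMeasure (negMeasure μ)

theorem variationNorm_eq (μ : RegularSignedMeasure K) :
    variationNorm μ = (posMeasure μ).real Set.univ + (negMeasure μ).real Set.univ := by
  rw [variationNorm, totalVariation_eq, measureReal_add_apply]

theorem variationNorm_eq_apply (μ : RegularSignedMeasure K) :
    variationNorm μ = (absMeasure μ : SignedMeasure K) Set.univ := by
  rw [variationNorm_eq, ← ofMeasure_apply _ .univ, ← ofMeasure_apply _ .univ]
  rfl

theorem variationNorm_nonneg (μ : RegularSignedMeasure K) : 0 ≤ variationNorm μ :=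
  measureReal_nonneg

/-! ### Riesz representation and approximation of the Hahn decomposition -/

section Integration

variable [CompactSpace K]

omit [T2Space K] in
theorem integrable_continuousMap (f : C(K, ℝ)) (ρ : Measure K) [IsFiniteMeasure ρ] :
    Integrable f ρ :=
  (BoundedContinuousFunction.mkOfCompact f).integrable ρ

omit [T2Space K] in
theorem vectorMeasure_integrable (f : C(K, ℝ)) (μ : SignedMeasure K) : μ.Integrable f := by
  rw [VectorMeasure.Integrable, ← SignedMeasure.totalVariation_eq_variation]
  exact integrable_continuousMap f _

theorem integral_eq_sub (μ : RegularSignedMeasure K) (f : C(K, ℝ)) :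
    ∫ᵛ t, f t ∂<•(μ : SignedMeasure K) = ∫ t, f t ∂posMeasure μ - ∫ t, f t ∂negMeasure μ := by
  conv_lhs => rw [eq_sub μ]
  refine (VectorMeasure.integral_sub_vectorMeasure (vectorMeasure_integrable f _)
    (vectorMeasure_integrable f _)).trans ?_
  rw [← VectorMeasure.integral_toSignedMeasure, ← VectorMeasure.integral_toSignedMeasure]
  rfl

omit [T2Space K] [BorelSpace K] in
theorem abs_integral_le_norm_mul (f : C(K, ℝ)) (ρ : Measure K) [IsFiniteMeasure ρ] :
    |∫ t, f t ∂ρ| ≤ ‖f‖ * ρ.real Set.univ :=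
  norm_integral_le_of_norm_le_const (ae_of_all _ f.norm_coe_le_norm)

theorem abs_vectorIntegral_le (μ : RegularSignedMeasure K) (f : C(K, ℝ)) :
    |∫ᵛ t, f t ∂<•(μ : SignedMeasure K)| ≤ variationNorm μ * ‖f‖ := by
  rw [integral_eq_sub, variationNorm_eq]
  refine (abs_sub _ _).trans ?_
  linarith [abs_integral_le_norm_mul f (posMeasure μ), abs_integral_le_norm_mul f (negMeasure μ)]

/-- Integration of continuous functions, as a map into the dual of `C(K)`. -/
def toDual : RegularSignedMeasure K →ₗ[ℝ] StrongDual ℝ C(K, ℝ) where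
  toFun μ := LinearMap.mkContinuous
    { toFun := fun f => ∫ᵛ t, f t ∂<•(μ : SignedMeasure K)
      map_add' := fun f g => VectorMeasure.integral_fun_add (vectorMeasure_integrable f _)
        (vectorMeasure_integrable g _)
      map_smul' := fun c f => VectorMeasure.integral_fun_smul _ _ c f }
    (variationNorm μ) (abs_vectorIntegral_le μ)
  map_add' μ ν := by
    ext f
    exact VectorMeasure.integral_add_vectorMeasure (vectorMeasure_integrable f _)
      (vectorMeasure_integrable f _)
  map_smul' c μ := by
    ext f
    exact VectorMeasure.integral_smul_vectorMeasure _ c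

theorem toDual_ofMeasure (ρ : Measure K) [IsFiniteMeasure ρ] [ρ.Regular] (f : C(K, ℝ)) :
    toDual (ofMeasure ρ) f = ∫ t, f t ∂ρ := VectorMeasure.integral_toSignedMeasure

theorem toDual_ofMeasure_one (ρ : Measure K) [IsFiniteMeasure ρ] [ρ.Regular] :
    toDual (ofMeasure ρ) 1 = ρ.real Set.univ := by
  simp [toDual_ofMeasure]

theorem toDual_ofMeasure_mono (ρ : Measure K) [IsFiniteMeasure ρ] [ρ.Regular] {f g : C(K, ℝ)}
    (h : f ≤ g) : toDual (ofMeasure ρ) f ≤ toDual (ofMeasure ρ) g := by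
  rw [toDual_ofMeasure, toDual_ofMeasure]
  exact integral_mono (integrable_continuousMap f ρ) (integrable_continuousMap g ρ) h

theorem toDual_ofMeasure_nonneg (ρ : Measure K) [IsFiniteMeasure ρ] [ρ.Regular] {f : C(K, ℝ)}
    (h : 0 ≤ f) : 0 ≤ toDual (ofMeasure ρ) f := by
  simpa using toDual_ofMeasure_mono ρ h

theorem toDual_eq_sub (μ : RegularSignedMeasure K) (f : C(K, ℝ)) : toDual μ f =
    toDual (ofMeasure (posMeasure μ)) f - toDual (ofMeasure (negMeasure μ)) f := by
  rw [toDual_ofMeasure, toDual_ofMeasure]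
  exact integral_eq_sub μ f

theorem toDual_absMeasure (μ : RegularSignedMeasure K) (f : C(K, ℝ)) : toDual (absMeasure μ) f =
    toDual (ofMeasure (posMeasure μ)) f + toDual (ofMeasure (negMeasure μ)) f := by
  rw [absMeasure, map_add, _root_.add_apply]

theorem norm_toDual_le (μ : RegularSignedMeasure K) : ‖toDual μ‖ ≤ variationNorm μ :=
  ContinuousLinearMap.opNorm_le_bound _ (variationNorm_nonneg μ) (abs_vectorIntegral_le μ)

/-- A continuous function which approximates the indicator function of a positive Hahn set. -/
theorem exists_approx_hahn (μ : RegularSignedMeasure K) {ε : ℝ} (hε : 0 < ε) :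
    ∃ h : C(K, ℝ), 0 ≤ h ∧ h ≤ 1 ∧
      toDual (ofMeasure (posMeasure μ)) (1 - h) + toDual (ofMeasure (negMeasure μ)) h ≤ ε := by
  simp only [toDual_ofMeasure]
  obtain ⟨S, hS, h1, h2, -⟩ := exists_hahn μ
  have hε' : ENNReal.ofReal (ε / 2) ≠ 0 := (ENNReal.ofReal_pos.2 (half_pos hε)).ne'
  -- Regularity gives compact sets inside the two Hahn sets with small remainders, and Urysohn's
  -- lemma separates them.
  obtain ⟨F₁, hF₁S, hF₁, hlt₁⟩ := hS.exists_isCompact_sdiff_lt (measure_ne_top (posMeasure μ) S) hε'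
  obtain ⟨F₂, hF₂S, hF₂, hlt₂⟩ :=
    hS.compl.exists_isCompact_sdiff_lt (measure_ne_top (negMeasure μ) Sᶜ) hε'
  obtain ⟨h, hh0, hh1, hh⟩ := exists_continuous_zero_one_of_isClosed hF₂.isClosed hF₁.isClosed
    (Set.disjoint_left.2 fun t ht2 ht1 => hF₂S ht2 (hF₁S ht1))
  have hbound : ∀ (ρ : Measure K) [IsFiniteMeasure ρ] (g : C(K, ℝ)) (F S : Set K),
      MeasurableSet F → ρ Sᶜ = 0 → ρ (S \ F) < ENNReal.ofReal (ε / 2) → (∀ t, g t ≤ 1) →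
      (∀ t ∈ F, g t = 0) → ∫ t, g t ∂ρ ≤ ε / 2 := by
    intro ρ _ g F S hF hS0 hlt hg hgF
    have hle : ρ Fᶜ ≤ ENNReal.ofReal (ε / 2) := calc
      ρ Fᶜ ≤ ρ (Sᶜ ∪ S \ F) := measure_mono fun t ht => by
          by_cases hts : t ∈ S
          · exact Or.inr ⟨hts, ht⟩
          · exact Or.inl hts
      _ ≤ ρ Sᶜ + ρ (S \ F) := measure_union_le _ _
      _ ≤ _ := by rw [hS0, zero_add]; exact hlt.le
    calc ∫ t, g t ∂ρ ≤ ∫ t, Fᶜ.indicator (fun _ => (1 : ℝ)) t ∂ρ := by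
          refine integral_mono (integrable_continuousMap g ρ)
            ((integrable_const 1).indicator hF.compl) fun t => ?_
          by_cases ht : t ∈ F
          · simp [ht, hgF]
          · simpa [ht] using hg t
      _ = ρ.real Fᶜ := by rw [integral_indicator_const _ hF.compl]; simp
      _ ≤ ε / 2 := ENNReal.toReal_le_of_le_ofReal (by positivity) hle
  refine ⟨h, fun t => (hh t).1, fun t => (hh t).2, ?_⟩
  have e1 := hbound (posMeasure μ) (1 - h) F₁ S hF₁.measurableSet h1 hlt₁
    (fun t => by simpa using (hh t).1) (fun t ht => by simp [hh1 ht])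
  have e2 := hbound (negMeasure μ) h F₂ Sᶜ hF₂.measurableSet (by rwa [compl_compl]) hlt₂
    (fun t => (hh t).2) (fun t ht => by simpa using hh0 ht)
  linarith

/-- `∫ F d|μ|` is approximated by the integrals of `F g` against `μ` with `|g| ≤ 1`. -/
theorem exists_toDual_mul_ge (μ : RegularSignedMeasure K) (F : C(K, ℝ)) {ε : ℝ}
    (hε : 0 < ε) : ∃ g : C(K, ℝ), |g| ≤ 1 ∧ toDual (absMeasure μ) F - ε ≤ toDual μ (F * g) := by
  have hC : 0 < 2 * (‖F‖ + 1) := by positivity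
  obtain ⟨h, h0, h1, hle⟩ := exists_approx_hahn μ (div_pos hε hC)
  -- The function 2h - 1 imitates the sign of μ: the defect is 2∫F(1 - h)dμ⁺ + 2∫Fh dμ⁻, which
  -- explains the constant 2(‖F‖ + 1).
  refine ⟨h + h - 1, fun t => ?_, ?_⟩
  · have e0 : 0 ≤ h t := h0 t
    have e1 : h t ≤ 1 := h1 t
    change |h t + h t - 1| ≤ 1
    rw [abs_le]
    constructor <;> linarith
  · have hb : ∀ k : C(K, ℝ), 0 ≤ k → F * k ≤ (‖F‖ + 1) • k := fun k hk t => by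
      have e2 : F t ≤ ‖F‖ := (le_abs_self _).trans (F.norm_coe_le_norm t)
      change F t * k t ≤ (‖F‖ + 1) * k t
      exact mul_le_mul_of_nonneg_right (by linarith) (hk t)
    have e1 := toDual_ofMeasure_mono (posMeasure μ) (hb (1 - h) (sub_nonneg.2 h1))
    have e2 := toDual_ofMeasure_mono (negMeasure μ) (hb h h0)
    simp only [mul_sub, mul_one, map_sub, map_smul, smul_eq_mul] at e1 e2 hle
    rw [toDual_absMeasure, toDual_eq_sub μ]
    simp only [mul_add, mul_sub, mul_one, map_add, map_sub]
    rw [le_div_iff₀ hC] at hle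
    linarith

/-- For odd `n`, the variation norm is approximated by integrals of `n`-th powers. -/
theorem exists_toDual_pow_ge_variationNorm (μ : RegularSignedMeasure K) {n : ℕ} (hn : Odd n)
    {ε : ℝ} (hε : 0 < ε) :
    ∃ x : C(K, ℝ), ‖x‖ ≤ 1 ∧ variationNorm μ - ε ≤ toDual μ (x ^ n) := by
  have hn0 : (0 : ℝ) < n := by exact_mod_cast hn.pos
  have hC : 0 < 2 * (n : ℝ) := by positivity
  obtain ⟨h, h0, h1, hle⟩ := exists_approx_hahn μ (div_pos hε hC)
  refine ⟨h + h - 1, (ContinuousMap.norm_le _ zero_le_one).2 fun t => ?_, ?_⟩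
  · have e0 : 0 ≤ h t := h0 t
    have e1 : h t ≤ 1 := h1 t
    change |h t + h t - 1| ≤ 1
    rw [abs_le]
    constructor <;> linarith
  -- Bernoulli's inequality bounds the power below near h = 1; oddness turns it into the upper bound
  -- near h = 0.
  · have b1 : 1 - (2 * (n : ℝ)) • (1 - h) ≤ (h + h - 1) ^ n := fun t => by
      have e0 : 0 ≤ h t := h0 t
      have := one_add_mul_le_pow (a := 2 * (h t - 1)) (by linarith) n
      change 1 - 2 * (n : ℝ) * (1 - h t) ≤ (h t + h t - 1) ^ n
      rw [show h t + h t - 1 = 1 + 2 * (h t - 1) by ring]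
      linarith
    have b2 : (h + h - 1) ^ n ≤ (2 * (n : ℝ)) • h - 1 := fun t => by
      have e0 : h t ≤ 1 := h1 t
      have := one_add_mul_le_pow (a := -(2 * h t)) (by linarith) n
      change (h t + h t - 1) ^ n ≤ 2 * (n : ℝ) * h t - 1
      rw [show h t + h t - 1 = -(1 + -(2 * h t)) by ring, hn.neg_pow]
      linarith
    have e1 := toDual_ofMeasure_mono (posMeasure μ) b1
    have e2 := toDual_ofMeasure_mono (negMeasure μ) b2
    rw [le_div_iff₀ hC] at hle
    simp only [map_sub, map_smul, smul_eq_mul, toDual_ofMeasure_one] at e1 e2 hle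
    rw [toDual_eq_sub, variationNorm_eq]
    linarith

theorem exists_toDual_pow_ge_posMeasure (μ : RegularSignedMeasure K) (n : ℕ) {ε : ℝ} (hε : 0 < ε) :
    ∃ x : C(K, ℝ), ‖x‖ ≤ 1 ∧ (posMeasure μ).real Set.univ - ε ≤ toDual μ (x ^ (n + 1)) := by
  have hC : 0 < (n : ℝ) + 1 := by positivity
  obtain ⟨h, h0, h1, hle⟩ := exists_approx_hahn μ (div_pos hε hC)
  refine ⟨h, (ContinuousMap.norm_le _ zero_le_one).2 fun t => ?_, ?_⟩
  · have e1 : h t ≤ 1 := h1 t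
    exact (Real.norm_of_nonneg (h0 t)).trans_le e1
  · have b1 : 1 - ((n : ℝ) + 1) • (1 - h) ≤ h ^ (n + 1) := fun t => by
      have e0 : 0 ≤ h t := h0 t
      have := one_add_mul_le_pow (a := h t - 1) (by linarith) (n + 1)
      change 1 - ((n : ℝ) + 1) * (1 - h t) ≤ h t ^ (n + 1)
      rw [add_sub_cancel] at this
      push_cast at this
      linarith
    -- The cruder factor n + 1 matches the one in `b1`, so a single estimate on h serves both parts.
    have b2 : h ^ (n + 1) ≤ ((n : ℝ) + 1) • h := fun t => by
      have e0 : 0 ≤ h t := h0 t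
      change h t ^ (n + 1) ≤ ((n : ℝ) + 1) * h t
      have e1 : h t ^ n ≤ 1 := pow_le_one₀ e0 (h1 t)
      rw [pow_succ]
      refine mul_le_mul_of_nonneg_right (e1.trans ?_) e0
      linarith [n.cast_nonneg (α := ℝ)]
    have e1 := toDual_ofMeasure_mono (posMeasure μ) b1
    have e2 := toDual_ofMeasure_mono (negMeasure μ) b2
    rw [le_div_iff₀ hC] at hle
    simp only [map_sub, map_smul, smul_eq_mul, toDual_ofMeasure_one] at e1 e2 hle
    rw [toDual_eq_sub]
    linarith

/-- The lower bound is the case n = 1 of the approximation by odd powers. -/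
theorem norm_toDual (μ : RegularSignedMeasure K) : ‖toDual μ‖ = variationNorm μ := by
  refine le_antisymm (norm_toDual_le μ) (le_of_forall_pos_le_add fun ε hε => ?_)
  obtain ⟨x, hx, h⟩ := exists_toDual_pow_ge_variationNorm μ odd_one hε
  have h1 := (le_abs_self _).trans ((toDual μ).le_opNorm (x ^ 1))
  rw [pow_one] at h h1
  have h2 : ‖toDual μ‖ * ‖x‖ ≤ ‖toDual μ‖ := mul_le_of_le_one_right (toDual μ).opNorm_nonneg hx
  linarith

theorem toDual_nonneg_iff (μ : RegularSignedMeasure K) :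
    (∀ f, 0 ≤ f → 0 ≤ toDual μ f) ↔ 0 ≤ μ := by
  have hiff : 0 ≤ μ ↔ negMeasure μ = 0 := by
    rw [le_iff]
    constructor
    · intro h
      obtain ⟨S, hS, -, -, h1⟩ := exists_hahn μ
      have h2 : 0 ≤ (μ : SignedMeasure K) (Set.univ ∩ Sᶜ) := h _ (MeasurableSet.univ.inter hS.compl)
      have h3 := (h1 _ .univ).2
      have h4 : (negMeasure μ).real Set.univ = 0 :=
        le_antisymm (by linarith) measureReal_nonneg
      rwa [measureReal_eq_zero_iff, Measure.measure_univ_eq_zero] at h4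
    · intro h B hB
      rw [apply_eq μ hB, h]
      simp
  rw [hiff]
  constructor
  · intro h
    have h1 : (negMeasure μ).real Set.univ ≤ 0 := le_of_forall_pos_le_add fun ε hε => by
      obtain ⟨k, hk0, hk1, hle⟩ := exists_approx_hahn μ hε
      -- 1 - k nearly indicates the negative Hahn set, so its integral is at most ε - ‖μ⁻‖₁.
      have h2 := h (1 - k) (sub_nonneg.2 hk1)
      rw [toDual_eq_sub] at h2
      simp only [map_sub, toDual_ofMeasure_one] at h2 hle
      linarith
    have h2 := le_antisymm h1 measureReal_nonneg
    rwa [measureReal_eq_zero_iff, Measure.measure_univ_eq_zero] at h2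
  · intro h f hf
    rw [toDual_eq_sub, toDual_ofMeasure _ f, toDual_ofMeasure _ f, h, integral_zero_measure, sub_zero]
    exact integral_nonneg hf

theorem toDual_le_iff {μ ν : RegularSignedMeasure K} :
    (∀ f, 0 ≤ f → toDual μ f ≤ toDual ν f) ↔ μ ≤ ν := by
  have h1 : μ ≤ ν ↔ 0 ≤ ν - μ := by
    rw [le_iff, le_iff]
    exact forall₂_congr fun B _ => sub_nonneg.symm
  rw [h1, ← toDual_nonneg_iff]
  exact forall₂_congr fun f _ => by rw [map_sub toDual ν μ]; exact sub_nonneg.symm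

/-- The Riesz representation theorem for signed measures. -/
theorem toDual_bijective : Function.Bijective (toDual (K := K)) := by
  constructor
  · intro μ ν h
    exact le_antisymm (toDual_le_iff.1 fun f _ => by rw [h]) (toDual_le_iff.1 fun f _ => by rw [h])
  · intro φ
    obtain ⟨ψ₁, ψ₂, h1, h2, h⟩ := exists_positive_sub_eq φ
    obtain ⟨ρ₁, _, _, hρ₁⟩ := exists_regular_measure_eq ψ₁ h1
    obtain ⟨ρ₂, _, _, hρ₂⟩ := exists_regular_measure_eq ψ₂ h2
    refine ⟨ofMeasure ρ₁ - ofMeasure ρ₂, ?_⟩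
    ext f
    rw [map_sub toDual (ofMeasure ρ₁) (ofMeasure ρ₂), _root_.sub_apply, toDual_ofMeasure, toDual_ofMeasure, h, hρ₁, hρ₂]

theorem norm_smul_strongDual {E : Type*} [NormedAddCommGroup E] [NormedSpace ℝ E] (c : ℝ)
    (φ : StrongDual ℝ E) : ‖c • φ‖ = |c| * ‖φ‖ := norm_smul c φ

theorem exists_tendsto_norm_sub_strongDual {E : Type*} [NormedAddCommGroup E] [NormedSpace ℝ E]
    (u : ℕ → StrongDual ℝ E) (hu : ∀ ε > 0, ∃ m, ∀ k ≥ m, ∀ l ≥ m, ‖u k - u l‖ < ε) :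
    ∃ φ, Tendsto (fun k => ‖u k - φ‖) atTop (𝓝 0) := by
  have hc : CauchySeq u := Metric.cauchySeq_iff.2 fun ε hε => by
    simpa only [dist_eq_norm] using hu ε hε
  obtain ⟨φ, hφ⟩ := cauchySeq_tendsto_of_complete hc
  exact ⟨φ, tendsto_iff_norm_sub_tendsto_zero.1 hφ⟩

theorem isNorm_variationNorm : IsNorm (variationNorm (K := K)) where
  eq_zero μ h := toDual_bijective.1 (by
    rw [← norm_toDual] at h
    rw [map_zero]
    exact (toDual μ).opNorm_zero_iff.1 h)
  smul c μ := by rw [← norm_toDual, ← norm_toDual, map_smul]; exact norm_smul_strongDual c _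
  add_le μ ν := by
    rw [← norm_toDual, ← norm_toDual, ← norm_toDual, map_add]
    exact ContinuousLinearMap.opNorm_add_le _ _

omit [CompactSpace K] in
-- By translation, μ ∨ ν = ν + (μ - ν)⁺.
theorem isLUB_pair (μ ν : RegularSignedMeasure K) :
    IsLUB {μ, ν} (ν + ofMeasure (posMeasure (μ - ν))) := by
  have hle : ∀ a b c : RegularSignedMeasure K, a ≤ b + c ↔ a - b ≤ c := fun a b c => by
    rw [le_iff, le_iff]
    exact forall₂_congr fun B _ => sub_le_iff_le_add'.symm
  obtain ⟨h1, h2⟩ := isLUB_zero (μ - ν)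
  constructor
  · rintro σ (rfl | rfl) <;> rw [hle]
    · exact h1 (by simp)
    · rw [sub_self σ]
      exact h1 (by simp)
  · intro σ hσ
    have e : σ = ν + (σ - ν) := (add_sub_cancel ν σ).symm
    have h3 := h2 (show σ - ν ∈ upperBounds {μ - ν, 0} by
      rintro τ (rfl | rfl)
      · rw [← hle, ← e]; exact hσ (by simp)
      · rw [← sub_self ν, ← hle, ← e]; exact hσ (by simp))
    rw [le_iff] at h3 ⊢
    intro B hB
    exact le_sub_iff_add_le'.1 (h3 B hB)

theorem isBanachLattice_variationNorm : IsBanachLattice (variationNorm (K := K)) where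
  toIsNorm := isNorm_variationNorm
  add_le_add u v w h := le_iff.2 fun B hB => add_le_add (le_iff.1 h B hB) le_rfl
  smul_le_smul c u v hc h := le_iff.2 fun B hB => mul_le_mul_of_nonneg_left (le_iff.1 h B hB) hc
  exists_sup u v := ⟨_, isLUB_pair u v⟩
  exists_inf u v := by
    have hneg : ∀ a b : RegularSignedMeasure K, -a ≤ b → -b ≤ a := fun a b h =>
      le_iff.2 fun B hB => neg_le.1 (le_iff.1 h B hB)
    have hneg' : ∀ a b : RegularSignedMeasure K, a ≤ -b → b ≤ -a := fun a b h =>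
      le_iff.2 fun B hB => le_neg.1 (le_iff.1 h B hB)
    obtain ⟨h1, h2⟩ := isLUB_pair (-u) (-v)
    refine ⟨-(-v + ofMeasure (posMeasure (-u - -v))), ?_, fun σ hσ => hneg' _ _ (h2 ?_)⟩
    · rintro τ (rfl | rfl)
      · exact hneg _ _ (h1 (by simp))
      · exact hneg _ _ (h1 (by simp))
    · rintro τ (rfl | rfl)
      · exact hneg' _ _ (by rw [neg_neg u]; exact hσ (by simp))
      · exact hneg' _ _ (by rw [neg_neg v]; exact hσ (by simp))
  solid u v a b ha hb hab := by
    rw [variationNorm_eq_apply, variationNorm_eq_apply]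
    have ha' : a = absMeasure u := ha.unique (isLUB_neg u)
    have hb' : b = absMeasure v := hb.unique (isLUB_neg v)
    rw [← ha', ← hb']
    exact le_iff.1 hab _ .univ
  -- Completeness is inherited from the dual of `C(K)` through the isometric bijection `toDual`.
  complete u hu := by
    obtain ⟨φ, hφ⟩ := exists_tendsto_norm_sub_strongDual (fun k => toDual (u k)) fun ε hε => by
      obtain ⟨m, hm⟩ := hu ε hε
      refine ⟨m, fun k hk l hl => ?_⟩
      have h1 := hm k hk l hl
      rw [← norm_toDual, map_sub toDual (u k) (u l)] at h1
      exact h1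
    obtain ⟨v, rfl⟩ := toDual_bijective.2 φ
    refine ⟨v, hφ.congr fun k => ?_⟩
    rw [← norm_toDual, map_sub toDual (u k) v]

end Integration

end RegularSignedMeasure

/-! ### Transport of norms and lattice structure along a linear bijection -/

section Transfer

variable {V W : Type*} [AddCommGroup V] [Module ℝ V] [AddCommGroup W] [Module ℝ W]
  {J : V ≃ₗ[ℝ] W} {N : V → ℝ} {N' : W → ℝ}

theorem IsNorm.isIsometricIso (hN : IsNorm N) (h : ∀ v, N' (J v) = N v) :
    IsIsometricIso J N N' where
  isNorm_source := hN
  isNorm_target :=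
    { eq_zero := fun w hw => by
        obtain ⟨v, rfl⟩ := J.surjective w
        rw [hN.eq_zero v (by rw [← h, hw]), map_zero]
      smul := fun c w => by
        obtain ⟨v, rfl⟩ := J.surjective w
        rw [← map_smul, h, h, hN.smul]
      add_le := fun w w' => by
        obtain ⟨v, rfl⟩ := J.surjective w
        obtain ⟨v', rfl⟩ := J.surjective w'
        rw [← map_add, h, h, h]
        exact hN.add_le v v' }
  norm_eq := h

theorem IsBanachLattice.isBanachLatticeIsometricIso [PartialOrder V] [PartialOrder W]
    (hN : IsBanachLattice N) (h : ∀ v, N' (J v) = N v) (hJ : ∀ u v, J u ≤ J v ↔ u ≤ v) :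
    IsBanachLatticeIsometricIso J N N' := by
  have hiso := hN.toIsNorm.isIsometricIso h
  have hlub : ∀ u v s, IsLUB {J u, J v} (J s) ↔ IsLUB {u, v} s := fun u v s => by
    simp only [IsLUB, IsLeast, mem_lowerBounds, mem_upperBounds, Set.mem_insert_iff,
      Set.mem_singleton_iff, forall_eq_or_imp, forall_eq, J.surjective.forall, hJ]
  have hglb : ∀ u v s, IsGLB {J u, J v} (J s) ↔ IsGLB {u, v} s := fun u v s => by
    simp only [IsGLB, IsGreatest, mem_lowerBounds, mem_upperBounds, Set.mem_insert_iff,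
      Set.mem_singleton_iff, forall_eq_or_imp, forall_eq, J.surjective.forall, hJ]
  refine
    { toIsIsometricIso := hiso
      source := hN
      target :=
        { toIsNorm := hiso.isNorm_target
          add_le_add := ?_
          smul_le_smul := ?_
          exists_sup := ?_
          exists_inf := ?_
          solid := ?_
          complete := ?_ }
      map_sup := fun u v s => (hlub u v s).2
      map_inf := fun u v s => (hglb u v s).2 }
  · simp only [J.surjective.forall, ← map_add, hJ]
    exact hN.add_le_add
  · simp only [J.surjective.forall, ← map_smul, hJ]
    exact hN.smul_le_smul
  · simp only [J.surjective.forall, J.surjective.exists, hlub]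
    exact hN.exists_sup
  · simp only [J.surjective.forall, J.surjective.exists, hglb]
    exact hN.exists_inf
  · simp only [J.surjective.forall, ← map_neg, hlub, hJ, h]
    exact hN.solid
  · intro u hu
    obtain ⟨v, hv⟩ := hN.complete (fun k => J.symm (u k)) (by
      simpa only [← h, map_sub, LinearEquiv.apply_symm_apply] using hu)
    refine ⟨J v, ?_⟩
    simpa only [← h, map_sub, LinearEquiv.apply_symm_apply] using hv

end Transfer

namespace RegularSignedMeasure

/-! ### The norm ‖·‖₀ -/

section ZeroNorm

variable {K : Type*} [TopologicalSpace K] [T2Space K] [MeasurableSpace K] [BorelSpace K]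

theorem posMeasure_neg (μ : RegularSignedMeasure K) : posMeasure (-μ) = negMeasure μ := by
  change (-(μ : SignedMeasure K)).toJordanDecomposition.posPart = _
  rw [SignedMeasure.toJordanDecomposition_neg]
  rfl

theorem zeroNorm_eq (μ : RegularSignedMeasure K) :
    zeroNorm μ = max ((posMeasure μ).real Set.univ) ((posMeasure (-μ)).real Set.univ) := by
  rw [posMeasure_neg]
  rfl

theorem zeroNorm_neg (μ : RegularSignedMeasure K) : zeroNorm (-μ) = zeroNorm μ := by
  rw [zeroNorm_eq, zeroNorm_eq, neg_neg μ, max_comm]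

/-- μ⁺ + ν⁺ is an upper bound of μ + ν and 0, hence dominates (μ + ν)⁺. -/
theorem posMeasure_add_le (μ ν : RegularSignedMeasure K) :
    (posMeasure (μ + ν)).real Set.univ ≤
      (posMeasure μ).real Set.univ + (posMeasure ν).real Set.univ := by
  have h : ofMeasure (posMeasure (μ + ν)) ≤ ofMeasure (posMeasure μ) + ofMeasure (posMeasure ν) := by
    refine (isLUB_zero (μ + ν)).2 ?_
    have h1 := fun σ : RegularSignedMeasure K => le_iff.1 ((isLUB_zero σ).1 (show σ ∈ _ by simp))
    have h2 := fun σ : RegularSignedMeasure K => le_iff.1 ((isLUB_zero σ).1 (show 0 ∈ _ by simp))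
    rintro τ (rfl | rfl) <;> rw [le_iff] <;> intro B hB
    · exact add_le_add (h1 μ B hB) (h1 ν B hB)
    · exact add_nonneg (h2 μ B hB) (h2 ν B hB)
  have h3 := le_iff.1 h _ .univ
  rw [← ofMeasure_apply _ .univ, ← ofMeasure_apply _ .univ, ← ofMeasure_apply _ .univ]
  exact h3

theorem zeroNorm_smul_of_nonneg {c : ℝ} (hc : 0 ≤ c) (μ : RegularSignedMeasure K) :
    zeroNorm (c • μ) = c * zeroNorm μ := by
  change max ((c • (μ : SignedMeasure K)).toJordanDecomposition.posPart.real Set.univ)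
    ((c • (μ : SignedMeasure K)).toJordanDecomposition.negPart.real Set.univ) = _
  rw [SignedMeasure.toJordanDecomposition_smul_real,
    JordanDecomposition.real_smul_posPart_nonneg _ _ hc,
    JordanDecomposition.real_smul_negPart_nonneg _ _ hc, measureReal_nnreal_smul_apply,
    measureReal_nnreal_smul_apply, Real.coe_toNNReal c hc, ← mul_max_of_nonneg _ _ hc]
  rfl

theorem isNorm_zeroNorm [CompactSpace K] : IsNorm (zeroNorm (K := K)) where
  eq_zero μ h := by
    refine isNorm_variationNorm.eq_zero μ ?_
    have h1 : (posMeasure μ).real Set.univ ≤ 0 := (le_max_left _ _).trans h.le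
    have h2 : (negMeasure μ).real Set.univ ≤ 0 := (le_max_right _ _).trans h.le
    exact le_antisymm (by rw [variationNorm_eq]; linarith) (variationNorm_nonneg μ)
  smul c μ := by
    rcases le_total 0 c with hc | hc
    · rw [zeroNorm_smul_of_nonneg hc, abs_of_nonneg hc]
    · rw [abs_of_nonpos hc, ← zeroNorm_smul_of_nonneg (neg_nonneg.2 hc), neg_smul c μ, zeroNorm_neg]
  add_le μ ν := by
    simp only [zeroNorm_eq]
    have h1 := posMeasure_add_le μ ν
    have h2 := posMeasure_add_le (-μ) (-ν)
    rw [← neg_add μ ν] at h2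
    exact max_le (h1.trans (add_le_add (le_max_left _ _) (le_max_left _ _)))
      (h2.trans (add_le_add (le_max_right _ _) (le_max_right _ _)))

end ZeroNorm

/-! ### Absolute values and norms of the power polynomials -/

variable {K : Type*} [TopologicalSpace K] [CompactSpace K] [T2Space K] [MeasurableSpace K]
  [BorelSpace K] {n : ℕ} [NeZero n]

/-- A competing bound `R` need not be orthogonally additive, so its form `B` is compared directly.
Approximate ∫∏vᵢ d|μ| by the integral of g∏vᵢ against μ with |g| ≤ 1, and put f = v₀g. Using B ≥ ±P
on f⁺ and f⁻ bounds this by B(|f|, v₁, …), which is at most B(v₀, v₁, …) because B is positive and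
|f| ≤ v₀. -/
theorem isLUB_powPoly_toDual (μ : RegularSignedMeasure K) :
    IsLUB {(powPoly n (toDual μ) : HomogPoly n C(K, ℝ)), -(powPoly n (toDual μ) : HomogPoly n C(K, ℝ))}
      (powPoly n (toDual (absMeasure μ)) : HomogPoly n C(K, ℝ)) := by
  have hneg : -(powPoly n (toDual μ) : HomogPoly n C(K, ℝ)) =
      (powPoly n (toDual (-μ)) : HomogPoly n C(K, ℝ)) := by
    rw [map_neg toDual μ, map_neg]
    rfl
  have habs := (isLUB_neg μ).1
  constructor
  · rw [hneg]
    rintro Q (rfl | rfl)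
    · exact powPoly_le_iff.2 (toDual_le_iff.2 (habs (by simp)))
    · exact powPoly_le_iff.2 (toDual_le_iff.2 (habs (by simp)))
  · intro R hR
    obtain ⟨A, B, hA, hB, h1⟩ : (powPoly n (toDual μ) : HomogPoly n C(K, ℝ)) ≤ R := hR (by simp)
    obtain ⟨A', B', hA', hB', h2⟩ : (powPoly n (toDual (-μ)) : HomogPoly n C(K, ℝ)) ≤ R :=
      hR (by simp [hneg])
    obtain rfl := hB.unique hB'
    obtain rfl := hA.unique (isFormOf_powPoly _)
    obtain rfl := hA'.unique (isFormOf_powPoly _)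
    simp only [powForm_apply, map_neg toDual μ, _root_.neg_apply] at h1 h2
    have hB0 : ∀ v : Fin n → C(K, ℝ), (∀ i, 0 ≤ v i) → 0 ≤ B v := fun v hv => by
      linarith [h1 v hv, h2 v hv]
    refine ⟨_, B, isFormOf_powPoly _, hB, fun v hv => ?_⟩
    rw [powForm_apply]
    refine le_of_forall_pos_le_add fun ε hε => ?_
    obtain ⟨g, hg, hle⟩ := exists_toDual_mul_ge μ (∏ i, v i) hε
    set f := v 0 * g with hf
    have hupd : ∀ k : C(K, ℝ), 0 ≤ k → ∀ i, 0 ≤ Function.update v 0 k i := fun k hk i => by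
      by_cases hi : i = 0
      · subst hi; simpa using hk
      · simpa [hi] using hv i
    have hprod : ∀ k : C(K, ℝ), ∏ i, Function.update v 0 k i =
        k * ∏ i ∈ Finset.univ.erase 0, v i := fun k => by
      rw [Finset.prod_update_of_mem (Finset.mem_univ _), Finset.sdiff_singleton_eq_erase]
    have e1 : (∏ i, v i) * g = f⁺ * ∏ i ∈ Finset.univ.erase 0, v i
        - f⁻ * ∏ i ∈ Finset.univ.erase 0, v i := by
      rw [← sub_mul, posPart_sub_negPart, hf, ← Finset.mul_prod_erase _ v (Finset.mem_univ 0)]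
      ring
    have e2 := h1 _ (hupd f⁺ (posPart_nonneg f))
    have e3 := h2 _ (hupd f⁻ (negPart_nonneg f))
    rw [hprod] at e2 e3
    have e4 := hB0 _ (hupd (v 0 - (f⁺ + f⁻)) (fun t => by
      have h0 : 0 ≤ v 0 t := hv 0 t
      have h3 : |g t| ≤ 1 := hg t
      have h4 : (f⁺ + f⁻) t = |v 0 t * g t| := by
        rw [posPart_add_negPart]
        rfl
      change 0 ≤ v 0 t - (f⁺ + f⁻) t
      rw [h4, abs_mul, abs_of_nonneg h0]
      exact sub_nonneg.2 (mul_le_of_le_one_right h0 h3)))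
    rw [B.map_update_sub, B.map_update_add, Function.update_eq_self] at e4
    rw [e1, map_sub] at hle
    linarith

theorem absVal_powPoly_toDual (μ : RegularSignedMeasure K) :
    HomogPoly.absVal (powPoly n (toDual μ) : HomogPoly n C(K, ℝ)) =
      (powPoly n (toDual (absMeasure μ)) : HomogPoly n C(K, ℝ)) := by
  have h : ∃ Q, IsLUB {(powPoly n (toDual μ) : HomogPoly n C(K, ℝ)),
      -(powPoly n (toDual μ) : HomogPoly n C(K, ℝ))} Q := ⟨_, isLUB_powPoly_toDual μ⟩
  rw [HomogPoly.absVal, dif_pos h]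
  exact h.choose_spec.unique (isLUB_powPoly_toDual μ)

omit [T2Space K] [MeasurableSpace K] [BorelSpace K] in
theorem supNorm_powPoly_eq {φ : StrongDual ℝ C(K, ℝ)} {c : ℝ}
    (h1 : ∀ x : C(K, ℝ), ‖x‖ ≤ 1 → |φ (x ^ n)| ≤ c)
    (h2 : ∀ ε > 0, ∃ x : C(K, ℝ), ‖x‖ ≤ 1 ∧ c - ε ≤ |φ (x ^ n)|) :
    HomogPoly.supNorm (powPoly n φ : HomogPoly n C(K, ℝ)) = c := by
  refine IsLUB.csSup_eq ⟨?_, fun b hb => le_of_forall_pos_le_add fun ε hε => ?_⟩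
    ⟨_, 0, by simp, rfl⟩
  · rintro r ⟨x, hx, rfl⟩
    exact h1 x hx
  · obtain ⟨x, hx, hle⟩ := h2 ε hε
    have : |φ (x ^ n)| ≤ b := hb ⟨x, hx, rfl⟩
    linarith

omit [T2Space K] [MeasurableSpace K] [BorelSpace K] in
theorem norm_pow_le_one {x : C(K, ℝ)} (hx : ‖x‖ ≤ 1) : ‖x ^ n‖ ≤ 1 :=
  (norm_pow_le' x (NeZero.pos n)).trans (pow_le_one₀ (norm_nonneg _) hx)

theorem regularNorm_powPoly_toDual (μ : RegularSignedMeasure K) :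
    HomogPoly.regularNorm (powPoly n (toDual μ) : HomogPoly n C(K, ℝ)) = variationNorm μ := by
  rw [HomogPoly.regularNorm, absVal_powPoly_toDual]
  have hone : toDual (absMeasure μ) 1 = variationNorm μ := by
    rw [toDual_absMeasure, toDual_ofMeasure_one, toDual_ofMeasure_one, variationNorm_eq]
  -- For the positive measure |μ| the supremum is attained at x = 1.
  refine supNorm_powPoly_eq (fun x hx => ?_) fun ε hε => ⟨1, ?_, ?_⟩
  · have h0 : ∀ f : C(K, ℝ), ‖f‖ ≤ 1 → toDual (absMeasure μ) f ≤ variationNorm μ := fun f hf => by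
      have hf1 : f ≤ 1 := fun t => (le_abs_self _).trans ((f.norm_coe_le_norm t).trans hf)
      rw [← hone, toDual_absMeasure, toDual_absMeasure]
      exact add_le_add (toDual_ofMeasure_mono _ hf1) (toDual_ofMeasure_mono _ hf1)
    have h1 := h0 _ (norm_pow_le_one (n := n) hx)
    have h2 := h0 (-x ^ n) (by rw [norm_neg]; exact norm_pow_le_one hx)
    rw [map_neg] at h2
    exact abs_le.2 ⟨by linarith, h1⟩
  · exact (ContinuousMap.norm_le _ zero_le_one).2 fun t => by simp
  · rw [one_pow, hone]
    linarith [le_abs_self (variationNorm μ)]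

theorem supNorm_powPoly_toDual_of_odd (hn : Odd n) (μ : RegularSignedMeasure K) :
    HomogPoly.supNorm (powPoly n (toDual μ) : HomogPoly n C(K, ℝ)) = variationNorm μ := by
  refine supNorm_powPoly_eq (fun x hx => ?_) fun ε hε => ?_
  · refine (abs_vectorIntegral_le μ (x ^ n)).trans ?_
    exact mul_le_of_le_one_right (variationNorm_nonneg μ) (norm_pow_le_one hx)
  · obtain ⟨x, hx, hle⟩ := exists_toDual_pow_ge_variationNorm μ hn hε
    exact ⟨x, hx, hle.trans (le_abs_self _)⟩

theorem supNorm_powPoly_toDual_of_even (hn : Even n) (μ : RegularSignedMeasure K) :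
    HomogPoly.supNorm (powPoly n (toDual μ) : HomogPoly n C(K, ℝ)) = zeroNorm μ := by
  refine supNorm_powPoly_eq (fun x hx => ?_) fun ε hε => ?_
  -- Since 0 ≤ xⁿ ≤ 1, the integrals against μ⁺ and μ⁻ are nonnegative and bounded by the masses, so
  -- their difference lies between -‖μ⁻‖₁ and ‖μ⁺‖₁.
  · have h0 : 0 ≤ x ^ n := fun t => hn.pow_nonneg (x t)
    have h1 : x ^ n ≤ 1 := fun t =>
      (le_abs_self _).trans (((x ^ n).norm_coe_le_norm t).trans (norm_pow_le_one hx))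
    have e1 := toDual_ofMeasure_nonneg (posMeasure μ) h0
    have e2 := toDual_ofMeasure_nonneg (negMeasure μ) h0
    have e3 := toDual_ofMeasure_mono (posMeasure μ) h1
    have e4 := toDual_ofMeasure_mono (negMeasure μ) h1
    rw [toDual_ofMeasure_one] at e3 e4
    have e5 : (posMeasure μ).real Set.univ ≤ zeroNorm μ := le_max_left _ _
    have e6 : (negMeasure μ).real Set.univ ≤ zeroNorm μ := le_max_right _ _
    rw [toDual_eq_sub, abs_le]
    constructor <;> linarith
  · obtain ⟨m, rfl⟩ := Nat.exists_eq_succ_of_ne_zero (NeZero.ne n)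
    obtain ⟨x, hx, hxle⟩ := exists_toDual_pow_ge_posMeasure μ m hε
    obtain ⟨y, hy, hyle⟩ := exists_toDual_pow_ge_posMeasure (-μ) m hε
    rw [zeroNorm_eq]
    rcases max_choice ((posMeasure μ).real Set.univ) ((posMeasure (-μ)).real Set.univ) with h | h
    · exact ⟨x, hx, by rw [h]; exact hxle.trans (le_abs_self _)⟩
    · refine ⟨y, hy, ?_⟩
      rw [h]
      rw [map_neg toDual μ, _root_.neg_apply] at hyle
      exact hyle.trans (neg_le_abs _)

end RegularSignedMeasure

end

theorem mainTheorem1 {K : Type*} [TopologicalSpace K] [CompactSpace K] [T2Space K]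
    [MeasurableSpace K] [BorelSpace K] (n : ℕ) (hn : 1 ≤ n) :
    ∃ J : RegularSignedMeasure K ≃ₗ[ℝ] OrthAddPoly n C(K, ℝ),
      (∀ (μ : RegularSignedMeasure K) (x : C(K, ℝ)),
        (J μ : HomogPoly n C(K, ℝ)) x = ∫ᵛ t, (x t) ^ n ∂<•(μ : SignedMeasure K)) ∧
      -- every orthogonally additive polynomial has an absolute value among all
      -- `n`-homogeneous polynomials, and it is orthogonally additive
      (∀ P : OrthAddPoly n C(K, ℝ), ∃ Q : OrthAddPoly n C(K, ℝ),
        IsLUB {(P : HomogPoly n C(K, ℝ)), -(P : HomogPoly n C(K, ℝ))} (Q : HomogPoly n C(K, ℝ))) ∧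
      IsBanachLatticeIsometricIso J RegularSignedMeasure.variationNorm
        (fun P : OrthAddPoly n C(K, ℝ) =>
          HomogPoly.regularNorm (P : HomogPoly n C(K, ℝ))) ∧
      (Odd n →
        (∀ P : OrthAddPoly n C(K, ℝ),
          HomogPoly.regularNorm (P : HomogPoly n C(K, ℝ)) =
            HomogPoly.supNorm (P : HomogPoly n C(K, ℝ))) ∧
        IsIsometricIso J RegularSignedMeasure.variationNorm
          (fun P : OrthAddPoly n C(K, ℝ) =>
            HomogPoly.supNorm (P : HomogPoly n C(K, ℝ)))) ∧
      (Even n →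
        IsIsometricIso J RegularSignedMeasure.zeroNorm
          (fun P : OrthAddPoly n C(K, ℝ) =>
            HomogPoly.supNorm (P : HomogPoly n C(K, ℝ)))) := by
  have : NeZero n := ⟨by omega⟩
  let J : RegularSignedMeasure K ≃ₗ[ℝ] OrthAddPoly n C(K, ℝ) :=
    (LinearEquiv.ofBijective _ RegularSignedMeasure.toDual_bijective).trans
      (LinearEquiv.ofBijective _ powPoly_bijective)
  have hJ : ∀ μ, J μ = powPoly n (RegularSignedMeasure.toDual μ) := fun _ => rfl
  refine ⟨J, fun μ x => rfl, fun P => ?_, ?_, fun hodd => ?_, fun heven => ?_⟩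
  · obtain ⟨μ, rfl⟩ := J.surjective P
    exact ⟨_, RegularSignedMeasure.isLUB_powPoly_toDual μ⟩
  · exact RegularSignedMeasure.isBanachLattice_variationNorm.isBanachLatticeIsometricIso
      RegularSignedMeasure.regularNorm_powPoly_toDual
      fun μ ν => powPoly_le_iff.trans RegularSignedMeasure.toDual_le_iff
  · refine ⟨fun P => ?_, RegularSignedMeasure.isNorm_variationNorm.isIsometricIso
      (RegularSignedMeasure.supNorm_powPoly_toDual_of_odd hodd)⟩
    obtain ⟨μ, rfl⟩ := J.surjective P
    rw [hJ, RegularSignedMeasure.regularNorm_powPoly_toDual,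
      RegularSignedMeasure.supNorm_powPoly_toDual_of_odd hodd]
  · exact RegularSignedMeasure.isNorm_zeroNorm.isIsometricIso
      (RegularSignedMeasure.supNorm_powPoly_toDual_of_even heven)
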